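/- Let $\mathbb{T}_d$ be the rooted $d$-regular tree, and let $X=(X(v))_{v\in\mathbb{T}_d}$ be a random labelling, that is, the labels $X(v)$ are independent and uniform on $[0,1]$. A graph automorphism $\varphi$ acts on labellings by $(\varphi\cdot x)(v)=x(\varphi^{-1}(v))$. A factor is a measurable function $f:[0,1]^{\mathbb{T}_d}\to\{0,1\}$ that is invariant under all automorphisms of $\mathbb{T}_d$ fixing the root. It generates the random set $I$ of vertices in which $v\in I$ if and only if $f(\varphi_v\cdot X)=1$, where $\varphi_v$ is any automorphism mapping $v$ to the root. If $I$ is an independent set with probability $1$, it is called a factor of i.i.d. independent set; its density is $\mathrm{density}(I)=\mathbb{P}(\mathrm{root}\in I)$. For $d\ge 2$ define $\alpha_d$ by $$\alpha_d\,\frac{\log d}{d}=\sup\{\mathrm{density}(I): I\text{ is a factor of i.i.d. independent set in }\mathbb{T}_d\}.$$ **Theorem.** $\limsup_{d\to\infty}\alpha_d\le 1$. In other words, for every $\varepsilon>0$ there is a $D$ such that for all $d>D$ every factor of i.i.d. independent set in $\mathbb{T}_d$ has density at most $(1+\varepsilon)\frac{\log d}{d}$. This bound is asymptotically sharp: $\alpha_d\to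 1$ as $d\to\infty$. -/

import Mathlib

open MeasureTheory Filter Topology

/-- The vertices of the `d`-regular tree: words in `d` letters in which consecutive letters are
distinct.  The empty word has `d` one-letter extensions on the left; any other word has `d - 1`
of them, and one parent (its tail). -/
abbrev TreeVertex (d : ℕ) : Type := {w : List (Fin d) // w.IsChain (· ≠ ·)}

/-- The rooted `d`-regular tree `𝕋_d`: a word is joined to its tail. -/
def regularTree (d : ℕ) : SimpleGraph (TreeVertex d) where
  Adj u v := (∃ a, v.1 = a :: u.1) ∨ (∃ a, u.1 = a :: v.1)
  symm := ⟨fun _ _ h => h.symm⟩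
  loopless := ⟨fun u h => by
    rcases h with ⟨a, h⟩ | ⟨a, h⟩ <;> simpa using congrArg List.length h⟩

/-- The root of `𝕋_d`. -/
def treeRoot (d : ℕ) : TreeVertex d := ⟨[], List.IsChain.nil⟩

/-- Labellings of `𝕋_d` by elements of `[0, 1]`. -/
abbrev TreeLabelling (d : ℕ) : Type := TreeVertex d → unitInterval

/-- The law of the random labelling of `𝕋_d`: independent uniform labels. -/
noncomputable def labelMeasure (d : ℕ) : Measure (TreeLabelling d) :=
  Measure.infinitePi fun _ => (volume : Measure unitInterval)

/-- The action of graph automorphisms on labellings: `(φ · x) v = x (φ⁻¹ v)`. -/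
def relabel {d : ℕ} (φ : regularTree d ≃g regularTree d) (x : TreeLabelling d) :
    TreeLabelling d :=
  fun v => x (φ.symm v)

/-- A factor on `𝕋_d`: a measurable `{0, 1}`-valued function of the labelling which is invariant
under all root-preserving automorphisms. -/
structure IsFactor {d : ℕ} (f : TreeLabelling d → Bool) : Prop where
  measurable : Measurable f
  invariant : ∀ φ : regularTree d ≃g regularTree d, φ (treeRoot d) = treeRoot d →
    ∀ x, f (relabel φ x) = f x

/-- The set-valued process `I` generated by `f`: the vertex `v` belongs to `I` if
`f (φ · X) = 1`, where `φ` is an automorphism that maps `v` to the root.  Such a `φ` exists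
(`exists_iso_root`), and its choice does not matter if `f` is a factor
(`mem_factorProcess_iff`). -/
def factorProcess {d : ℕ} (f : TreeLabelling d → Bool) (x : TreeLabelling d) :
    Set (TreeVertex d) :=
  {v | ∃ φ : regularTree d ≃g regularTree d, φ v = treeRoot d ∧ f (relabel φ x) = true}

theorem mem_factorProcess_iff {d : ℕ} {f : TreeLabelling d → Bool} (hf : IsFactor f)
    (x : TreeLabelling d) {v : TreeVertex d} (φ : regularTree d ≃g regularTree d)
    (hφ : φ v = treeRoot d) : v ∈ factorProcess f x ↔ f (relabel φ x) = true := by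
  constructor
  · rintro ⟨ψ, hψ, h⟩
    have hr : φ (ψ.symm (treeRoot d)) = treeRoot d := by
      rw [← hψ, RelIso.symm_apply_apply, hφ, hψ]
    have h1 := hf.invariant (ψ.symm.trans φ) hr (relabel ψ x)
    rw [← h, ← h1]
    congr 1
    funext w
    simp [relabel]
  · exact fun h => ⟨φ, hφ, h⟩

/-- Multiplication by the letter `i` at the far end of a word. -/
def endMul {d : ℕ} (i : Fin d) : List (Fin d) → List (Fin d)
  | [] => [i]
  | [a] => if a = i then [] else [a, i]
  | a :: b :: l => a :: endMul i (b :: l)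

theorem endMul_concat {d : ℕ} (i : Fin d) (l : List (Fin d)) : endMul i (l ++ [i]) = l := by
  induction l with
  | nil => simp [endMul]
  | cons a l ih => cases l with
    | nil => simp [endMul]
    | cons b l => simpa [endMul] using ih

theorem endMul_isChain {d : ℕ} (i : Fin d) (l : List (Fin d)) (h : l.IsChain (· ≠ ·)) :
    (endMul i l).IsChain (· ≠ ·) := by
  induction l with
  | nil => simp [endMul]
  | cons a l ih => cases l with
    | nil => by_cases hai : a = i <;> simp [endMul, hai]
    | cons b l =>
      rw [List.isChain_cons_cons] at h
      have ih' := ih h.2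
      cases l with
      | nil => by_cases hbi : b = i <;> simp_all [endMul]
      | cons c l => simp_all [endMul]

theorem endMul_endMul {d : ℕ} (i : Fin d) (l : List (Fin d)) (h : l.IsChain (· ≠ ·)) :
    endMul i (endMul i l) = l := by
  induction l with
  | nil => simp [endMul]
  | cons a l ih => cases l with
    | nil => by_cases hai : a = i <;> simp [endMul, hai]
    | cons b l =>
      rw [List.isChain_cons_cons] at h
      have ih' := ih h.2
      cases l with
      | nil => by_cases hbi : b = i <;> simp_all [endMul]
      | cons c l => cases l <;> simp_all [endMul]

theorem endMul_adj {d : ℕ} (i : Fin d) (u v : List (Fin d)) (h : ∃ a, v = a :: u) :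
    (∃ a, endMul i v = a :: endMul i u) ∨ (∃ a, endMul i u = a :: endMul i v) := by
  obtain ⟨a, rfl⟩ := h
  cases u with
  | nil => by_cases hai : a = i <;> simp [endMul, hai]
  | cons b l => exact Or.inl ⟨a, rfl⟩

/-- The automorphism of `𝕋_d` given by `endMul i`. -/
def endMulIso {d : ℕ} (i : Fin d) : regularTree d ≃g regularTree d where
  toFun w := ⟨endMul i w.1, endMul_isChain i w.1 w.2⟩
  invFun w := ⟨endMul i w.1, endMul_isChain i w.1 w.2⟩
  left_inv w := Subtype.ext (endMul_endMul i w.1 w.2)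
  right_inv w := Subtype.ext (endMul_endMul i w.1 w.2)
  map_rel_iff' := by
    have key : ∀ u v : List (Fin d), ((∃ a, v = a :: u) ∨ (∃ a, u = a :: v)) →
        (∃ a, endMul i v = a :: endMul i u) ∨ (∃ a, endMul i u = a :: endMul i v) := by
      rintro u v (h | h)
      · exact endMul_adj i u v h
      · exact (endMul_adj i v u h).symm
    intro u v
    refine ⟨fun h => ?_, fun h => key u.1 v.1 h⟩
    have := key _ _ h
    simp only [Equiv.coe_fn_mk, endMul_endMul i u.1 u.2, endMul_endMul i v.1 v.2] at this
    exact this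

/-- The automorphism group of `𝕋_d` acts transitively on the vertices. -/
theorem exists_iso_root {d : ℕ} (v : TreeVertex d) :
    ∃ φ : regularTree d ≃g regularTree d, φ v = treeRoot d := by
  obtain ⟨l, hl⟩ := v
  induction l using List.reverseRecOn with
  | nil => exact ⟨RelIso.refl _, rfl⟩
  | append_singleton l i ih =>
    have hl' : l.IsChain (· ≠ ·) := (List.isChain_append.1 hl).1
    obtain ⟨φ, hφ⟩ := ih hl'
    refine ⟨(endMulIso i).trans φ, ?_⟩
    rw [← hφ]
    exact congrArg φ (Subtype.ext (endMul_concat i l))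

/-- `f` is a factor whose process is with probability one an independent set of `𝕋_d`. -/
structure IsIndepSetFactor {d : ℕ} (f : TreeLabelling d → Bool) : Prop where
  isFactor : IsFactor f
  indep : ∀ᵐ x ∂(labelMeasure d), (regularTree d).IsIndepSet (factorProcess f x)

/-- The density of the process generated by `f`: the probability that it contains the root. -/
noncomputable def factorDensity {d : ℕ} (f : TreeLabelling d → Bool) : ℝ :=
  (labelMeasure d).real {x | treeRoot d ∈ factorProcess f x}

/-- The supremum of the densities of factor of i.i.d. independent sets in `𝕋_d`. -/
noncomputable def supIndepDensity (d : ℕ) : ℝ :=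
  sSup {ρ | ∃ f : TreeLabelling d → Bool, IsIndepSetFactor f ∧ ρ = factorDensity f}

/-- The number `α_d` with `α_d * (log d / d) = supIndepDensity d` (meaningful for `d ≥ 2`). -/
noncomputable def treeAlpha (d : ℕ) : ℝ := supIndepDensity d / (Real.log d / d)

/-! Upper bound. Let local functions of i.i.d. seeds sit on the vertices of a finite `d`-regular
Cayley graph of large girth. Forgetting the seeds one at a time gives `d * I ≤ 2 * H`, where `I` is
the mutual information across an edge and `H` the entropy at a vertex (`sum_condEntropy_edge_le`).
If neighbouring values never conflict, `I` is at least the probability that two independent values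
conflict (`conflict_le_mutualInfo`). For a single independent set of density `ρ` this reads `d * ρ²
≲ 2ρ log (1/ρ)`, which is too weak by a factor two.

The factor is recovered with `m` copies of the set that share the labels, except that each label is
resampled independently in the copies with probability `p` (`degree_mul_copies_le`). Let `Q` be the
conditional probability, given the shared data, that the root is chosen, and `Q'` an independent
version of it. A conflict has probability `E[1 - (1 - QQ')^m]`, and the entropy is about `u log
(1/u)` with `u = E[1 - (1 - Q)^m]`. Averaging over a geometric `m` and normalising replaces `1 - (1
- x)^m` by `φ x = (1 + δ) x / (x + δ)`. As `p` runs from 0 to 1, `E[φ Q]` moves continuously from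
`ρ` to `φ ρ`, so some `p` gives `E[φ Q] = Mρ`. For `δ = 1/M²` the averaged conflict is at least
`ρ²(2M - 2)`, and the averaged entropy at most `Mρ log (1/ρ) + O_M(ρ)`. Hence `d * ρ * (1 - 1/M) ≤
log (1/ρ) + C_M` (`degree_mul_localDensity_le`), and a large `M` gives the constant `1 + ε`.
Measurable factors reduce to local rules on finite alphabets by approximation
(`exists_localDensity_gt`).

Lower bound. The greedy set, in which vertices join in the order of their labels, is approximated by
factors. Since subtrees below distinct children are independent, the distribution functions of the
join times are Picard iterates (`measureReal_rootedGreedySet_succ`). Their limit is explicit, and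
the limiting density is `(1 - (d - 1)^(-2/(d - 2))) / 2`, which is asymptotic to `log d / d`. -/

set_option linter.unusedSectionVars false

/-! ### Finite product spaces and the entropy gained by forgetting coordinates. -/

section FiniteProduct

variable {V Λ A C : Type*} [Fintype V] [DecidableEq V] [Fintype Λ] [Fintype A] [DecidableEq A]
  [Fintype C] [DecidableEq C]

/-- The expectation of `F` when the coordinates are independent with weights `w`. -/
noncomputable def prodExpect (w : Λ → ℝ) (F : (V → Λ) → ℝ) : ℝ :=
  ∑ z, (∏ v, w (z v)) * F z

/-- The average of `F` over a fresh value of the coordinate `h`. -/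
noncomputable def resample (w : Λ → ℝ) (h : V) (F : (V → Λ) → ℝ) : (V → Λ) → ℝ :=
  fun z => ∑ t, w t * F (Function.update z h t)

/-- The average of `F` over fresh values of the coordinates in a list. -/
noncomputable def resampleList (w : Λ → ℝ) : List V → ((V → Λ) → ℝ) → (V → Λ) → ℝ
  | [], F => F
  | h :: l, F => resample w h (resampleList w l F)

theorem sum_prod_weight {w : Λ → ℝ} (hw : ∑ t, w t = 1) :
    ∑ z : V → Λ, ∏ v, w (z v) = 1 := by
  classical
  rw [← Fintype.prod_sum fun (_ : V) t => w t]
  simp [hw]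

theorem prodExpect_const {w : Λ → ℝ} (hw : ∑ t, w t = 1) (c : ℝ) :
    prodExpect (V := V) w (fun _ => c) = c := by
  rw [prodExpect, ← Finset.sum_mul, sum_prod_weight hw, one_mul]

theorem prodExpect_mono {w : Λ → ℝ} (hw : ∀ t, 0 ≤ w t) {F G : (V → Λ) → ℝ}
    (h : ∀ z, F z ≤ G z) : prodExpect w F ≤ prodExpect w G :=
  Finset.sum_le_sum fun z _ => mul_le_mul_of_nonneg_left (h z) (Finset.prod_nonneg fun _ _ => hw _)

theorem prodExpect_nonneg {w : Λ → ℝ} (hw : ∀ t, 0 ≤ w t) {F : (V → Λ) → ℝ}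
    (h : ∀ z, 0 ≤ F z) : 0 ≤ prodExpect w F :=
  Finset.sum_nonneg fun z _ => mul_nonneg (Finset.prod_nonneg fun _ _ => hw _) (h z)

theorem prodExpect_sub (w : Λ → ℝ) (F G : (V → Λ) → ℝ) :
    prodExpect w (fun z => F z - G z) = prodExpect w F - prodExpect w G := by
  simp [prodExpect, mul_sub, Finset.sum_sub_distrib]

theorem prodExpect_const_mul (w : Λ → ℝ) (c : ℝ) (F : (V → Λ) → ℝ) :
    prodExpect w (fun z => c * F z) = c * prodExpect w F := by
  simp [prodExpect, Finset.mul_sum, mul_left_comm]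

theorem prodExpect_finsetSum {ι : Type*} (w : Λ → ℝ) (s : Finset ι) (F : ι → (V → Λ) → ℝ) :
    prodExpect w (fun z => ∑ i ∈ s, F i z) = ∑ i ∈ s, prodExpect w (F i) := by
  simp only [prodExpect, Finset.mul_sum]
  exact Finset.sum_comm

theorem prodExpect_resample {w : Λ → ℝ} (hw : ∑ t, w t = 1) (h : V) (F : (V → Λ) → ℝ) :
    prodExpect w (resample w h F) = prodExpect w F := by
  -- Exchanging the value at `h` with the fresh value is an involution that preserves the joint
  -- weight.
  have e : ∀ p : (V → Λ) × Λ, (∏ v, w (p.1 v)) * w p.2 =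
      (∏ v, w (Function.update p.1 h p.2 v)) * w (p.1 h) := by
    rintro ⟨z, t⟩
    rw [← Finset.mul_prod_erase _ _ (Finset.mem_univ h),
      ← Finset.mul_prod_erase _ (fun v => w (Function.update z h t v)) (Finset.mem_univ h)]
    have : ∏ v ∈ Finset.univ.erase h, w (Function.update z h t v) =
        ∏ v ∈ Finset.univ.erase h, w (z v) :=
      Finset.prod_congr rfl fun v hv => by rw [Function.update_of_ne (Finset.ne_of_mem_erase hv)]
    simp only [this, Function.update_self]
    ring
  let σ : (V → Λ) × Λ → (V → Λ) × Λ := fun p => (Function.update p.1 h p.2, p.1 h)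
  have hσ : Function.Involutive σ := by rintro ⟨z, t⟩; simp [σ]
  calc prodExpect w (resample w h F)
      = ∑ p : (V → Λ) × Λ, (∏ v, w (p.1 v)) * w p.2 * F (σ p).1 := by
        simp only [prodExpect, resample, Fintype.sum_prod_type, Finset.mul_sum, mul_assoc, σ]
    _ = ∑ p : (V → Λ) × Λ, (∏ v, w ((σ p).1 v)) * w (σ p).2 * F (σ p).1 := by
        simp only [e, σ]
    _ = ∑ p : (V → Λ) × Λ, (∏ v, w (p.1 v)) * w p.2 * F p.1 :=
        Equiv.sum_comp hσ.toPerm fun p => (∏ v, w (p.1 v)) * w p.2 * F p.1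
    _ = prodExpect w F := by
        simp only [prodExpect, Fintype.sum_prod_type]
        refine Finset.sum_congr rfl fun z _ => ?_
        rw [← Finset.sum_mul, ← Finset.mul_sum, hw, mul_one]

theorem prodExpect_resampleList {w : Λ → ℝ} (hw : ∑ t, w t = 1) (l : List V)
    (F : (V → Λ) → ℝ) : prodExpect w (resampleList w l F) = prodExpect w F := by
  induction l with
  | nil => rfl
  | cons h l ih => rw [resampleList, prodExpect_resample hw, ih]

/-- `F` does not depend on the coordinate `h`. -/
def IgnoresCoord {β : Type*} (h : V) (F : (V → Λ) → β) : Prop :=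
  ∀ z t, F (Function.update z h t) = F z

theorem IgnoresCoord.resample_eq {w : Λ → ℝ} (hw : ∑ t, w t = 1) {h : V} {F : (V → Λ) → ℝ}
    (hF : IgnoresCoord h F) : resample w h F = F := by
  funext z
  simp only [resample, hF z, ← Finset.sum_mul, hw, one_mul]

theorem ignoresCoord_resample_self (w : Λ → ℝ) (h : V) (F : (V → Λ) → ℝ) :
    IgnoresCoord h (resample w h F) := by
  intro z t
  simp [resample]

theorem IgnoresCoord.resample {w : Λ → ℝ} {h : V} {F : (V → Λ) → ℝ}
    (hF : IgnoresCoord h F) (h' : V) : IgnoresCoord h (resample w h' F) := by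
  by_cases hh : h' = h
  · subst hh; exact ignoresCoord_resample_self w _ F
  · intro z t
    simp only [_root_.resample]
    refine Finset.sum_congr rfl fun s _ => ?_
    rw [Function.update_comm (Ne.symm hh), hF]

theorem IgnoresCoord.resampleList {w : Λ → ℝ} {h : V} {F : (V → Λ) → ℝ}
    (hF : IgnoresCoord h F) (l : List V) : IgnoresCoord h (resampleList w l F) := by
  induction l with
  | nil => exact hF
  | cons a l ih => exact ih.resample a

theorem ignoresCoord_resampleList_of_mem (w : Λ → ℝ) {h : V} (F : (V → Λ) → ℝ) {l : List V}
    (hl : h ∈ l) : IgnoresCoord h (resampleList w l F) := by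
  induction l with
  | nil => simp at hl
  | cons a l ih =>
    rcases List.mem_cons.1 hl with rfl | hl
    · exact ignoresCoord_resample_self w _ _
    · exact (ih hl).resample a

theorem eq_of_ignoresCoord {β : Type*} {F : (V → Λ) → β} (hF : ∀ h, IgnoresCoord h F)
    (z z' : V → Λ) : F z = F z' := by
  have : ∀ s : Finset V, F (s.piecewise z' z) = F z := by
    intro s
    induction s using Finset.induction_on with
    | empty => simp
    | insert a s _ ih => rw [Finset.piecewise_insert, hF a, ih]
  rw [← this Finset.univ, Finset.piecewise_univ]

theorem resampleList_univ {w : Λ → ℝ} (hw : ∑ t, w t = 1) (F : (V → Λ) → ℝ) (z : V → Λ) :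
    resampleList w Finset.univ.toList F z = prodExpect w F := by
  have h := eq_of_ignoresCoord (F := resampleList w Finset.univ.toList F) fun h =>
    ignoresCoord_resampleList_of_mem w F (by simp)
  rw [← prodExpect_resampleList hw Finset.univ.toList F, ← prodExpect_const (V := V) hw
    (resampleList w Finset.univ.toList F z)]
  congr 1
  funext z'
  exact h z z'

theorem resample_nonneg {w : Λ → ℝ} (hw : ∀ t, 0 ≤ w t) (h : V) {F : (V → Λ) → ℝ}
    (hF : ∀ z, 0 ≤ F z) (z : V → Λ) : 0 ≤ resample w h F z :=
  Finset.sum_nonneg fun t _ => mul_nonneg (hw t) (hF _)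

theorem resampleList_nonneg {w : Λ → ℝ} (hw : ∀ t, 0 ≤ w t) (l : List V) {F : (V → Λ) → ℝ}
    (hF : ∀ z, 0 ≤ F z) (z : V → Λ) : 0 ≤ resampleList w l F z := by
  induction l generalizing z with
  | nil => exact hF z
  | cons h l ih => exact resample_nonneg hw h ih z

theorem resampleList_finsetSum {ι : Type*} (w : Λ → ℝ) (l : List V) (s : Finset ι)
    (F : ι → (V → Λ) → ℝ) (z : V → Λ) :
    resampleList w l (fun z => ∑ i ∈ s, F i z) z = ∑ i ∈ s, resampleList w l (F i) z := by
  induction l generalizing z with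
  | nil => rfl
  | cons h l ih =>
    simp only [resampleList, resample, ih, Finset.mul_sum]
    exact Finset.sum_comm

/-- The conditional law of `Y` after the coordinates in `l` are forgotten. -/
noncomputable def condLaw (w : Λ → ℝ) (l : List V) (Y : (V → Λ) → A) (a : A) : (V → Λ) → ℝ :=
  resampleList w l fun z => if Y z = a then 1 else 0

/-- The conditional entropy of `Y` given the coordinates outside `l`. -/
noncomputable def condEntropy (w : Λ → ℝ) (l : List V) (Y : (V → Λ) → A) : ℝ :=
  prodExpect w fun z => ∑ a, Real.negMulLog (condLaw w l Y a z)

/-- The law of `Y`. -/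
noncomputable def law (w : Λ → ℝ) (Y : (V → Λ) → A) (a : A) : ℝ :=
  prodExpect w fun z => if Y z = a then 1 else 0

theorem condLaw_nonneg {w : Λ → ℝ} (hw : ∀ t, 0 ≤ w t) (l : List V) (Y : (V → Λ) → A) (a : A)
    (z : V → Λ) : 0 ≤ condLaw w l Y a z :=
  resampleList_nonneg hw l (fun z => by split_ifs <;> norm_num) z

theorem law_nonneg {w : Λ → ℝ} (hw : ∀ t, 0 ≤ w t) (Y : (V → Λ) → A) (a : A) : 0 ≤ law w Y a :=
  prodExpect_nonneg hw fun z => by split_ifs <;> norm_num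

theorem sum_law {w : Λ → ℝ} (hw : ∑ t, w t = 1) (Y : (V → Λ) → A) : ∑ a, law w Y a = 1 := by
  simp only [law]
  rw [← prodExpect_finsetSum]
  simp [prodExpect_const hw]

theorem condLaw_comp (w : Λ → ℝ) (l : List V) (X : (V → Λ) → A) (κ : A → C) (c : C)
    (z : V → Λ) : condLaw w l (κ ∘ X) c z = ∑ a with κ a = c, condLaw w l X a z := by
  simp only [condLaw]
  rw [← resampleList_finsetSum]
  congr 1
  funext z
  simp [Finset.sum_ite_eq]

theorem law_comp (w : Λ → ℝ) (X : (V → Λ) → A) (κ : A → C) (c : C) :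
    law w (κ ∘ X) c = ∑ a with κ a = c, law w X a := by
  simp only [law]
  rw [← prodExpect_finsetSum]
  congr 1
  funext z
  simp [Finset.sum_ite_eq]

theorem condEntropy_nil {w : Λ → ℝ} (hw : ∑ t, w t = 1) (Y : (V → Λ) → A) :
    condEntropy w [] Y = 0 := by
  rw [condEntropy, ← prodExpect_const (V := V) hw 0]
  congr 1
  funext z
  refine Finset.sum_eq_zero fun a _ => ?_
  simp only [condLaw, resampleList]
  split_ifs <;> simp

theorem condEntropy_univ {w : Λ → ℝ} (hw : ∑ t, w t = 1) (Y : (V → Λ) → A) :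
    condEntropy w Finset.univ.toList Y = ∑ a, Real.negMulLog (law w Y a) := by
  simp only [condEntropy, condLaw, resampleList_univ hw, prodExpect_const hw, law]

/-- The log-sum inequality: `a * log (b / a)` is jointly concave and homogeneous. The assumption `a
≤ b` keeps `b` positive wherever `a` is, so that the logarithms are meaningful. -/
theorem sum_mul_log_div_le {ι : Type*} (s : Finset ι) {w a b : ι → ℝ} (hw : ∀ t, 0 ≤ w t)
    (ha : ∀ t, 0 ≤ a t) (hab : ∀ t, a t ≤ b t) :
    ∑ t ∈ s, w t * (Real.negMulLog (a t) + a t * Real.log (b t)) ≤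
      Real.negMulLog (∑ t ∈ s, w t * a t) + (∑ t ∈ s, w t * a t) * Real.log (∑ t ∈ s, w t * b t) := by
  set P := ∑ t ∈ s, w t * a t with hP
  set R := ∑ t ∈ s, w t * b t with hR
  have hPn : 0 ≤ P := Finset.sum_nonneg fun t _ => mul_nonneg (hw t) (ha t)
  have hPR : P ≤ R := Finset.sum_le_sum fun t _ => mul_le_mul_of_nonneg_left (hab t) (hw t)
  rcases hPn.eq_or_lt with h0 | hpos
  · have hz : ∀ t ∈ s, w t * a t = 0 :=
      (Finset.sum_eq_zero_iff_of_nonneg fun t _ => mul_nonneg (hw t) (ha t)).1 h0.symm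
    have : ∑ t ∈ s, w t * (Real.negMulLog (a t) + a t * Real.log (b t)) = 0 := by
      refine Finset.sum_eq_zero fun t ht => ?_
      rw [Real.negMulLog]
      linear_combination (-Real.log (a t) + Real.log (b t)) * hz t ht
    rw [this, ← h0]; simp
  · have hRpos : 0 < R := hpos.trans_le hPR
    -- This is `log y ≤ y - 1` at `y = b P / (R a)`. The error terms `b P / R - a` have weighted sum
    -- zero.
    have key : ∀ t, Real.negMulLog (a t) + a t * Real.log (b t) ≤
        a t * (Real.log R - Real.log P) + (b t * (P / R) - a t) := by
      intro t
      rcases (ha t).eq_or_lt with h0 | hat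
      · rw [← h0]; simp only [Real.negMulLog_zero, zero_mul, zero_add, sub_zero]
        exact mul_nonneg ((ha t).trans (hab t)) (div_nonneg hpos.le hRpos.le)
      · have hbt := hat.trans_le (hab t)
        have h1 := Real.log_le_sub_one_of_pos (x := b t * P / (R * a t)) (by positivity)
        rw [Real.log_div (by positivity) (by positivity), Real.log_mul hbt.ne' hpos.ne',
          Real.log_mul hRpos.ne' hat.ne'] at h1
        have h2 := mul_le_mul_of_nonneg_left h1 hat.le
        have h3 : a t * (b t * P / (R * a t) - 1) = b t * (P / R) - a t := by field_simp
        rw [h3] at h2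
        rw [Real.negMulLog]
        linarith
    calc _ ≤ ∑ t ∈ s, w t * (a t * (Real.log R - Real.log P) + (b t * (P / R) - a t)) :=
          Finset.sum_le_sum fun t _ => mul_le_mul_of_nonneg_left (key t) (hw t)
      _ = P * (Real.log R - Real.log P) + (R * (P / R) - P) := by
          rw [hP, hR]
          simp only [mul_add, mul_sub, Finset.sum_add_distrib, Finset.sum_sub_distrib,
            Finset.sum_mul, mul_assoc]
      _ = _ := by rw [mul_div_cancel₀ _ hRpos.ne', Real.negMulLog]; ring

/-- By the chain rule this difference is the entropy of `X` given `κ ∘ X` and the remembered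
coordinates; the right side has the shape to which the log-sum inequality applies. -/
theorem condEntropy_sub_comp (w : Λ → ℝ) (l : List V) (X : (V → Λ) → A) (κ : A → C) :
    condEntropy w l X - condEntropy w l (κ ∘ X) =
      prodExpect w fun z => ∑ a, (Real.negMulLog (condLaw w l X a z) +
        condLaw w l X a z * Real.log (condLaw w l (κ ∘ X) (κ a) z)) := by
  rw [condEntropy, condEntropy, ← prodExpect_sub]
  congr 1
  funext z
  rw [Finset.sum_add_distrib, sub_eq_add_neg, ← Finset.sum_neg_distrib]
  congr 1
  rw [← Finset.sum_fiberwise (s := Finset.univ) (g := κ)]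
  refine Finset.sum_congr rfl fun c _ => ?_
  rw [Real.negMulLog, neg_mul, neg_neg]
  nth_rewrite 1 [condLaw_comp]
  rw [Finset.sum_mul]
  refine Finset.sum_congr rfl fun a ha => ?_
  rw [(Finset.mem_filter.1 ha).2]

/-- Forgetting a coordinate raises the entropy of a variable at least as much as it raises that of
a function of this variable. -/
theorem condEntropy_cons_sub_comp_le {w : Λ → ℝ} (hw : ∀ t, 0 ≤ w t) (hw1 : ∑ t, w t = 1)
    (h : V) (l : List V) (X : (V → Λ) → A) (κ : A → C) :
    condEntropy w (h :: l) (κ ∘ X) - condEntropy w l (κ ∘ X) ≤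
      condEntropy w (h :: l) X - condEntropy w l X := by
  -- Rearranged, the claim is that the entropy of `X` given `κ ∘ X` grows when one more coordinate
  -- is forgotten. Resampling `h` averages the conditional laws, so the log-sum inequality applies
  -- for each value of `X`.
  have : condEntropy w l X - condEntropy w l (κ ∘ X) ≤
      condEntropy w (h :: l) X - condEntropy w (h :: l) (κ ∘ X) := by
    rw [condEntropy_sub_comp, condEntropy_sub_comp, ← prodExpect_resample hw1 h]
    refine prodExpect_mono hw fun z => ?_
    simp only [resample, Finset.mul_sum]
    rw [Finset.sum_comm]
    refine Finset.sum_le_sum fun a _ => ?_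
    refine sum_mul_log_div_le _ hw (fun t => condLaw_nonneg hw l X a _) fun t => ?_
    rw [condLaw_comp]
    exact Finset.single_le_sum (f := fun a => condLaw w l X a _)
      (fun a _ => condLaw_nonneg hw l X a _) (by simp)
  linarith

/-- Compare with a constant image, whose entropy is zero whichever coordinates are forgotten. -/
theorem condEntropy_le_cons {w : Λ → ℝ} (hw : ∀ t, 0 ≤ w t) (hw1 : ∑ t, w t = 1)
    (h : V) (l : List V) (X : (V → Λ) → A) :
    condEntropy w l X ≤ condEntropy w (h :: l) X := by
  have h1 := condEntropy_cons_sub_comp_le hw hw1 h l X (fun _ => ())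
  have h2 : ∀ l : List V, condEntropy w l ((fun _ => ()) ∘ X) = 0 := by
    intro l
    rw [condEntropy, ← prodExpect_const (V := V) hw1 0]
    congr 1
    funext z
    have : ∀ z, condLaw w l ((fun _ => ()) ∘ X) () z = 1 := by
      intro z
      simp only [condLaw, if_true]
      induction l generalizing z with
      | nil => rfl
      | cons h l ih => simp [resampleList, resample, ih, hw1]
    simp [this]
  rw [h2, h2] at h1
  linarith

theorem condEntropy_cons_of_ignoresCoord {w : Λ → ℝ} (hw1 : ∑ t, w t = 1)
    {h : V} (l : List V) {X : (V → Λ) → A} (hX : IgnoresCoord h X) :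
    condEntropy w (h :: l) X = condEntropy w l X := by
  have : ∀ a, condLaw w (h :: l) X a = condLaw w l X a := fun a =>
    IgnoresCoord.resample_eq hw1 (IgnoresCoord.resampleList (fun z t => by simp only [hX z t]) l)
  simp only [condEntropy, this]

end FiniteProduct

/-! ### Finite locally tree-like Cayley graphs and the edge-vertex entropy inequality. -/

section Model

/-- Left multiplication of a word by a letter in the free product of `d` groups of order two. -/
def headMul {d : ℕ} (j : Fin d) : List (Fin d) → List (Fin d)
  | [] => [j]
  | a :: l => if a = j then l else j :: a :: l

theorem headMul_isChain {d : ℕ} (j : Fin d) {l : List (Fin d)} (h : l.IsChain (· ≠ ·)) :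
    (headMul j l).IsChain (· ≠ ·) := by
  cases l with
  | nil => simp [headMul]
  | cons a l =>
    by_cases haj : a = j
    · simpa [headMul, haj] using h.tail
    · simp [headMul, haj, List.isChain_cons_cons, h, Ne.symm haj]

theorem headMul_headMul {d : ℕ} (j : Fin d) {l : List (Fin d)} (h : l.IsChain (· ≠ ·)) :
    headMul j (headMul j l) = l := by
  cases l with
  | nil => simp [headMul]
  | cons a l =>
    by_cases haj : a = j
    · subst haj
      cases l with
      | nil => simp [headMul]
      | cons b l =>
        rw [List.isChain_cons_cons] at h
        simp [headMul, h.1.symm]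
    · simp [headMul, haj]

theorem headMul_of_isChain_cons {d : ℕ} {j : Fin d} {l : List (Fin d)}
    (h : (j :: l).IsChain (· ≠ ·)) : headMul j l = j :: l := by
  cases l with
  | nil => rfl
  | cons a l =>
    rw [List.isChain_cons_cons] at h
    simp [headMul, h.1.symm]

/-- The vertex reached from `g` along the word `w`, when the letters act by `s`. -/
def walkPos {d : ℕ} {V : Type*} (s : Fin d → V → V) : List (Fin d) → V → V
  | [], g => g
  | j :: w, g => s j (walkPos s w g)

/-- The far-end letter of a word acts first, so multiplying there is the same as moving the starting
vertex across an edge. -/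
theorem walkPos_endMul {d : ℕ} {V : Type*} {s : Fin d → V → V}
    (hs : ∀ j, Function.Involutive (s j)) (j : Fin d) (w : List (Fin d)) (g : V) :
    walkPos s (endMul j w) g = walkPos s w (s j g) := by
  induction w with
  | nil => rfl
  | cons a w ih =>
    cases w with
    | nil =>
      by_cases h : a = j
      · subst h; simp [endMul, walkPos, hs a g]
      · simp [endMul, walkPos, h]
    | cons b w => rw [endMul, walkPos, ih]; rfl

/-- Reduced words of length at most `N` lead to distinct vertices, from any starting vertex. -/
def LocallyTree {d : ℕ} {V : Type*} (s : Fin d → V → V) (N : ℕ) : Prop :=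
  ∀ g : V, ∀ w w' : List (Fin d), w.IsChain (· ≠ ·) → w'.IsChain (· ≠ ·) →
    w.length ≤ N → w'.length ≤ N → walkPos s w g = walkPos s w' g → w = w'

/-- There is a finite `d`-regular Cayley graph of large girth, generated by involutions. -/
theorem exists_locallyTree (d N : ℕ) : ∃ (V : Type) (_ : Fintype V) (_ : Nonempty V)
    (s : Fin d → V → V), (∀ j, Function.Involutive (s j)) ∧ LocallyTree s N := by
  classical
  let B : Type := {w : List (Fin d) // w.IsChain (· ≠ ·) ∧ w.length ≤ N}
  have : Finite B :=
    Set.Finite.to_subtype ((List.finite_length_le (Fin d) N).subset fun w hw => hw.2)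
  have : Fintype B := Fintype.ofFinite B
  -- Each letter acts on the ball of reduced words by left multiplication, and fixes a word that
  -- would leave the ball. These involutions generate the graph on the permutations of the ball.
  let σ : Fin d → B → B := fun j w => if h : (headMul j w.1).length ≤ N
    then ⟨headMul j w.1, headMul_isChain j w.2.1, h⟩ else w
  have hσ : ∀ j, Function.Involutive (σ j) := by
    intro j w
    by_cases h : (headMul j w.1).length ≤ N
    · have h1 : σ j w = ⟨headMul j w.1, headMul_isChain j w.2.1, h⟩ := dif_pos h
      rw [h1]
      apply Subtype.ext
      simp only [σ, headMul_headMul j w.2.1, w.2.2, dif_pos]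
    · have h1 : σ j w = w := dif_neg h
      rw [h1, h1]
  let s : Fin d → Equiv.Perm B → Equiv.Perm B := fun j g => (hσ j).toPerm * g
  let e : B := ⟨[], List.IsChain.nil, Nat.zero_le _⟩
  -- The endpoint remembers its word: follow the point that `g` sends to the empty word. All
  -- suffixes of `w` fit in the ball, so the truncation never interferes.
  have key : ∀ (g : Equiv.Perm B) (w : List (Fin d)), w.IsChain (· ≠ ·) → w.length ≤ N →
      (walkPos s w g (g⁻¹ e)).1 = w := by
    intro g w
    induction w with
    | nil => intro _ _; simp [walkPos, e]
    | cons j w ih =>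
      intro hw hl
      have ih' := ih hw.tail (by simp at hl; omega)
      have h1 : walkPos s (j :: w) g (g⁻¹ e) = σ j (walkPos s w g (g⁻¹ e)) := rfl
      rw [h1]
      have h2 : headMul j (walkPos s w g (g⁻¹ e)).1 = j :: w := by
        rw [ih', headMul_of_isChain_cons hw]
      simp only [σ, h2, hl, dif_pos]
  refine ⟨Equiv.Perm B, inferInstance, ⟨1⟩, s, fun j g => ?_, fun g w w' hw hw' hl hl' h => ?_⟩
  · ext1 x
    exact hσ j (g x)
  · rw [← key g w hw hl, ← key g w' hw' hl', h]

theorem endMul_length_le {d : ℕ} (j : Fin d) (w : List (Fin d)) :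
    (endMul j w).length ≤ w.length + 1 := by
  induction w with
  | nil => simp [endMul]
  | cons a w ih =>
    cases w with
    | nil => by_cases h : a = j <;> simp [endMul, h]
    | cons b w => simpa [endMul] using ih

theorem endMul_eq_concat_or {d : ℕ} (j : Fin d) (w : List (Fin d)) :
    (∃ l, w = l ++ [j]) ∨ endMul j w = w ++ [j] := by
  induction w with
  | nil => right; rfl
  | cons a w ih =>
    cases w with
    | nil =>
      by_cases h : a = j
      · left; exact ⟨[], by simp [h]⟩
      · right; simp [endMul, h]
    | cons b w =>
      rcases ih with ⟨l, hl⟩ | h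
      · left; exact ⟨a :: l, by rw [hl]; rfl⟩
      · right; rw [endMul, h]; rfl

variable {d : ℕ} {V Λ A : Type*} [Fintype V] [DecidableEq V] [Fintype Λ] [Fintype A] [DecidableEq A]

/-- The vertex `h` is reached from `g` by a short reduced word that ends with the letter `j`. -/
def ReachedVia (s : Fin d → V → V) (R : ℕ) (g h : V) (j : Fin d) : Prop :=
  ∃ l : List (Fin d), (l ++ [j]).IsChain (· ≠ ·) ∧ (l ++ [j]).length ≤ R ∧
    h = walkPos s (l ++ [j]) g

/-- The last letter of the word is the first step from `g` towards `h`, and short reduced words are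
determined by their endpoints. -/
theorem ReachedVia.unique {s : Fin d → V → V} {R N : ℕ} (hN : LocallyTree s N) (hR : R ≤ N)
    {g h : V} {j j' : Fin d} (hj : ReachedVia s R g h j) (hj' : ReachedVia s R g h j') :
    j = j' := by
  obtain ⟨l, h1, h2, h3⟩ := hj
  obtain ⟨l', h1', h2', h3'⟩ := hj'
  have := hN g _ _ h1 h1' (h2.trans hR) (h2'.trans hR) (h3.symm.trans h3')
  simpa using (List.append_inj' this rfl).2

/-- If both ends of an edge are close to `h`, their words to `h` differ by the letter `j` at the far
end, so one of the two paths starts with this edge. Comparing a word with the other one extended by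
`j` requires range `R + 1`. -/
theorem reachedVia_or {s : Fin d → V → V} (hs : ∀ j, Function.Involutive (s j)) {R : ℕ}
    (hN : LocallyTree s (R + 1)) {g h : V} (j : Fin d) {w w' : List (Fin d)}
    (hw : w.IsChain (· ≠ ·)) (hw' : w'.IsChain (· ≠ ·)) (hl : w.length ≤ R) (hl' : w'.length ≤ R)
    (hg : h = walkPos s w g) (hg' : h = walkPos s w' (s j g)) :
    ReachedVia s R g h j ∨ ReachedVia s R (s j g) h j := by
  have h1 : w = endMul j w' := by
    refine hN g _ _ hw (endMul_isChain j w' hw') (by omega)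
      ((endMul_length_le j w').trans (by omega)) ?_
    rw [walkPos_endMul hs, ← hg, ← hg']
  rcases endMul_eq_concat_or j w' with ⟨l, rfl⟩ | h2
  · right; exact ⟨l, hw', hl', hg'⟩
  · left
    rw [h2] at h1
    subst h1
    exact ⟨w', hw, hl, hg⟩

/-- The mutual informations along the edges of a locally tree-like graph add up to at most twice
the sum of the entropies of the vertices, for local functions of independent seeds. -/
theorem sum_condEntropy_edge_le {w : Λ → ℝ} (hw : ∀ t, 0 ≤ w t) (hw1 : ∑ t, w t = 1)
    {s : Fin d → V → V} (hs : ∀ j, Function.Involutive (s j)) {R : ℕ}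
    (hN : LocallyTree s (R + 1)) (Y : V → (V → Λ) → A)
    (hY : ∀ g h, (∀ u : List (Fin d), u.IsChain (· ≠ ·) → u.length ≤ R → h ≠ walkPos s u g) →
      IgnoresCoord h (Y g)) (l : List V) :
    ∑ g, ∑ j, (condEntropy w l (Y g) + condEntropy w l (Y (s j g)) -
        condEntropy w l (fun z => (Y g z, Y (s j g) z))) ≤ 2 * ∑ g, condEntropy w l (Y g) := by
  classical
  induction l with
  | nil => simp [condEntropy_nil hw1]
  | cons h l ih =>
    set a : V → ℝ := fun g => condEntropy w (h :: l) (Y g) - condEntropy w l (Y g) with ha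
    have ha0 : ∀ g, 0 ≤ a g := fun g => sub_nonneg.2 (condEntropy_le_cons hw hw1 h l (Y g))
    set b : V → Fin d → ℝ := fun g j => condEntropy w (h :: l) (fun z => (Y g z, Y (s j g) z)) -
      condEntropy w l (fun z => (Y g z, Y (s j g) z)) with hb
    -- Forgetting `h` raises the entropy of a pair at least as much as that of either component.
    have h1 : ∀ g j, a g ≤ b g j := fun g j =>
      condEntropy_cons_sub_comp_le hw hw1 h l (fun z => (Y g z, Y (s j g) z)) Prod.fst
    have h2 : ∀ g j, a (s j g) ≤ b g j := fun g j =>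
      condEntropy_cons_sub_comp_le hw hw1 h l (fun z => (Y g z, Y (s j g) z)) Prod.snd
    have hne : ∀ g, a g ≠ 0 → ∃ u : List (Fin d), u.IsChain (· ≠ ·) ∧ u.length ≤ R ∧
        h = walkPos s u g := by
      intro g hg
      by_contra! hc
      exact hg (sub_eq_zero.2 (condEntropy_cons_of_ignoresCoord hw1 l (hY g h hc)))
    set χ : V → Fin d → ℝ := fun g j => if ReachedVia s R g h j then 1 else 0 with hχ
    have hχ0 : ∀ g j, 0 ≤ χ g j := fun g j => by simp only [hχ]; split_ifs <;> norm_num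
    -- The gain in mutual information is charged to the end whose path to `h` starts with this edge;
    -- the pair term absorbs the increment of the other end. If only one end depends on `h`, nothing
    -- remains to be charged.
    have h3 : ∀ g j, a g + a (s j g) - b g j ≤ χ g j * a g + χ (s j g) j * a (s j g) := by
      intro g j
      have n1 := mul_nonneg (hχ0 g j) (ha0 g)
      have n2 := mul_nonneg (hχ0 (s j g) j) (ha0 (s j g))
      by_cases hg : a g = 0
      · linarith [h2 g j]
      by_cases hg' : a (s j g) = 0
      · linarith [h1 g j]
      obtain ⟨u, hu, hul, hug⟩ := hne g hg
      obtain ⟨u', hu', hul', hug'⟩ := hne _ hg'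
      rcases reachedVia_or hs hN j hu hu' hul hul' hug hug' with hr | hr
      · have : χ g j = 1 := if_pos hr
        rw [this]; linarith [h2 g j]
      · have : χ (s j g) j = 1 := if_pos hr
        rw [this]; linarith [h1 g j]
    -- Only one edge at `g` leads towards `h`, so a vertex is charged for at most one letter. The
    -- factor two arises since every edge is counted from both ends.
    have h4 : ∀ g, ∑ j, χ g j * a g ≤ a g := by
      intro g
      rw [← Finset.sum_mul]
      refine mul_le_of_le_one_left (ha0 g) ?_
      simp only [hχ, Finset.sum_boole]
      have : (Finset.univ.filter fun j => ReachedVia s R g h j).card ≤ 1 :=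
        Finset.card_le_one.2 fun i hi j hj => ReachedVia.unique hN (Nat.le_succ R)
          (Finset.mem_filter.1 hi).2 (Finset.mem_filter.1 hj).2
      exact_mod_cast this
    have h5 : ∑ g, ∑ j, χ (s j g) j * a (s j g) = ∑ g, ∑ j, χ g j * a g := by
      rw [Finset.sum_comm, Finset.sum_comm (γ := V)]
      refine Finset.sum_congr rfl fun j _ => ?_
      exact Equiv.sum_comp (hs j).toPerm fun g => χ g j * a g
    have h6 : ∑ g, ∑ j, (a g + a (s j g) - b g j) ≤ 2 * ∑ g, a g := by
      calc _ ≤ ∑ g, ∑ j, (χ g j * a g + χ (s j g) j * a (s j g)) :=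
            Finset.sum_le_sum fun g _ => Finset.sum_le_sum fun j _ => h3 g j
        _ = 2 * ∑ g, ∑ j, χ g j * a g := by
            simp only [Finset.sum_add_distrib, h5]; ring
        _ ≤ _ := by
            gcongr with g
            exact h4 g
    have h7 : ∑ g, a g = ∑ g, condEntropy w (h :: l) (Y g) - ∑ g, condEntropy w l (Y g) := by
      rw [ha, Finset.sum_sub_distrib]
    have h8 : ∑ g, ∑ j, (a g + a (s j g) - b g j) =
        ∑ g, ∑ j, (condEntropy w (h :: l) (Y g) + condEntropy w (h :: l) (Y (s j g)) -
          condEntropy w (h :: l) (fun z => (Y g z, Y (s j g) z))) -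
        ∑ g, ∑ j, (condEntropy w l (Y g) + condEntropy w l (Y (s j g)) -
          condEntropy w l (fun z => (Y g z, Y (s j g) z))) := by
      simp only [← Finset.sum_sub_distrib]
      refine Finset.sum_congr rfl fun g _ => Finset.sum_congr rfl fun j _ => ?_
      simp only [ha, hb]; ring
    rw [h7, h8] at h6
    linarith

end Model

/-! ### From mutual information to the probability of a conflict. -/

section Conflict

variable {V B Λ Λ' A : Type*} [Fintype V] [DecidableEq V] [Fintype B] [DecidableEq B]
  [Fintype Λ] [Fintype Λ'] [DecidableEq Λ'] [Fintype A] [DecidableEq A]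

theorem prodExpect_comp_injective {w : Λ → ℝ} (hw1 : ∑ t, w t = 1) {ι : B → V}
    (hι : Function.Injective ι) (Φ : (B → Λ) → ℝ) :
    prodExpect w (fun z : V → Λ => Φ (z ∘ ι)) = prodExpect w Φ := by
  classical
  have key : ∀ y : B → Λ, ∑ z : V → Λ, (if z ∘ ι = y then ∏ v, w (z v) else 0) =
      ∏ b, w (y b) := by
    intro y
    let u : V → Λ → ℝ := fun v t => if ∀ b, ι b = v → t = y b then w t else 0
    have h1 : ∀ z : V → Λ, (if z ∘ ι = y then ∏ v, w (z v) else 0) = ∏ v, u v (z v) := by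
      intro z
      by_cases hz : z ∘ ι = y
      · rw [if_pos hz]
        refine Finset.prod_congr rfl fun v _ => (if_pos ?_).symm
        rintro b rfl
        exact congrFun hz b
      · rw [if_neg hz]
        obtain ⟨b, hb⟩ := Function.ne_iff.1 hz
        refine (Finset.prod_eq_zero (Finset.mem_univ (ι b)) (if_neg fun h => hb (h b rfl))).symm
    simp only [h1]
    rw [← Fintype.prod_sum]
    refine (Fintype.prod_of_injective ι hι _ _ ?_ ?_).symm
    · intro v hv
      have : ∀ t, u v t = w t := fun t => if_pos fun b hb => (hv ⟨b, hb⟩).elim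
      simp [this, hw1]
    · intro b
      rw [Finset.sum_eq_single (y b)]
      · exact (if_pos fun b' hb' => by rw [hι hb']).symm
      · intro t _ ht
        exact if_neg fun h => ht (h b rfl)
      · simp
  calc prodExpect w (fun z : V → Λ => Φ (z ∘ ι))
      = ∑ z : V → Λ, ∑ y : B → Λ, (if z ∘ ι = y then ∏ v, w (z v) else 0) * Φ y := by
        refine Finset.sum_congr rfl fun z _ => ?_
        simp [ite_mul, Finset.sum_ite_eq]
    _ = ∑ y : B → Λ, (∏ b, w (y b)) * Φ y := by
        rw [Finset.sum_comm]
        refine Finset.sum_congr rfl fun y _ => ?_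
        rw [← Finset.sum_mul, key]
    _ = prodExpect w Φ := rfl

theorem prodExpect_comp_map (w : Λ → ℝ) (κ : Λ → Λ') (Φ : (B → Λ') → ℝ) :
    prodExpect w (fun z : B → Λ => Φ (κ ∘ z)) =
      prodExpect (fun t' => ∑ t, if κ t = t' then w t else 0) Φ := by
  classical
  have key : ∀ y : B → Λ', ∏ b, (∑ t, if κ t = y b then w t else 0) =
      ∑ z : B → Λ, if κ ∘ z = y then ∏ b, w (z b) else 0 := by
    intro y
    rw [Fintype.prod_sum]
    refine Finset.sum_congr rfl fun z _ => ?_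
    by_cases hz : κ ∘ z = y
    · rw [if_pos hz]
      exact Finset.prod_congr rfl fun b _ => if_pos (congrFun hz b)
    · rw [if_neg hz]
      obtain ⟨b, hb⟩ := Function.ne_iff.1 hz
      exact Finset.prod_eq_zero (Finset.mem_univ b) (if_neg hb)
  simp only [prodExpect, key, Finset.sum_mul]
  rw [Finset.sum_comm]
  refine Finset.sum_congr rfl fun z _ => ?_
  simp [ite_mul, Finset.sum_ite_eq]

/-- A lower bound for the mutual information of two variables that avoid the pairs in `K`. -/
theorem conflict_le_mutualInfo {w : Λ → ℝ} (hw : ∀ t, 0 ≤ w t) (hw1 : ∑ t, w t = 1)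
    (X X' : (V → Λ) → A) (K : A → A → Prop) [DecidableRel K] (hK : ∀ z, ¬ K (X z) (X' z)) :
    ∑ a, ∑ b, (if K a b then law w X a * law w X' b else 0) ≤
      ∑ a, Real.negMulLog (law w X a) + ∑ a, Real.negMulLog (law w X' a) -
        ∑ p, Real.negMulLog (law w (fun z => (X z, X' z)) p) := by
  set P : A → A → ℝ := fun a b => law w (fun z => (X z, X' z)) (a, b) with hP
  have hP0 : ∀ a b, 0 ≤ P a b := fun a b => law_nonneg hw _ _
  have m1 : ∀ a, law w X a = ∑ b, P a b := by
    intro a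
    have := law_comp w (fun z => (X z, X' z)) Prod.fst a
    rw [show Prod.fst ∘ (fun z => (X z, X' z)) = X from rfl] at this
    rw [this, Finset.sum_filter, Fintype.sum_prod_type, Finset.sum_comm]
    simp [hP]
  have m2 : ∀ b, law w X' b = ∑ a, P a b := by
    intro b
    have := law_comp w (fun z => (X z, X' z)) Prod.snd b
    rw [show Prod.snd ∘ (fun z => (X z, X' z)) = X' from rfl] at this
    rw [this, Finset.sum_filter, Fintype.sum_prod_type]
    simp [hP]
  have hKP : ∀ a b, K a b → P a b = 0 := by
    intro a b hab
    simp only [hP, law]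
    refine (congrArg (prodExpect w) (funext fun z => if_neg fun h => hK z ?_)).trans
      (prodExpect_const hw1 0)
    rw [Prod.mk.injEq] at h
    rwa [h.1, h.2]
  set p := law w X
  set q := law w X'
  have hp0 : ∀ a, 0 ≤ p a := law_nonneg hw X
  have hq0 : ∀ a, 0 ≤ q a := law_nonneg hw X'
  -- On the support of `P` this is `log y ≤ y - 1` at `y = p q / P`. Where `P` vanishes the right
  -- side is zero, which leaves room for the whole product mass of `K`. In the sum the first two
  -- terms cancel, since both have total mass one.
  have term : ∀ a b, P a b - p a * q b + (if K a b then p a * q b else 0) ≤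
      P a b * (Real.log (P a b) - Real.log (p a) - Real.log (q b)) := by
    intro a b
    rcases (hP0 a b).eq_or_lt with h0 | hpos
    · rw [← h0]
      have := mul_nonneg (hp0 a) (hq0 b)
      split_ifs <;> linarith
    · have hK' : ¬ K a b := fun h => hpos.ne' (hKP a b h)
      rw [if_neg hK', add_zero]
      have hpa : 0 < p a := hpos.trans_le <| by
        rw [m1]; exact Finset.single_le_sum (f := fun b => P a b) (fun b _ => hP0 a b) (Finset.mem_univ b)
      have hqb : 0 < q b := hpos.trans_le <| by
        rw [m2]; exact Finset.single_le_sum (f := fun a => P a b) (fun a _ => hP0 a b) (Finset.mem_univ a)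
      have h1 := Real.log_le_sub_one_of_pos (x := p a * q b / P a b) (by positivity)
      rw [Real.log_div (by positivity) hpos.ne', Real.log_mul hpa.ne' hqb.ne'] at h1
      have h2 := mul_le_mul_of_nonneg_left h1 hpos.le
      have h3 : P a b * (p a * q b / P a b - 1) = p a * q b - P a b := by field_simp
      rw [h3] at h2
      linarith
  have hsum := Finset.sum_le_sum fun a (_ : a ∈ Finset.univ) =>
    Finset.sum_le_sum fun b (_ : b ∈ Finset.univ) => term a b
  simp only [Finset.sum_add_distrib, Finset.sum_sub_distrib, mul_sub] at hsum
  have s1 : ∑ a, ∑ b, P a b = 1 := by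
    rw [← sum_law hw1 X]; exact Finset.sum_congr rfl fun a _ => (m1 a).symm
  have s2 : ∑ a, ∑ b, p a * q b = 1 := by
    rw [← Finset.sum_mul_sum, sum_law hw1, sum_law hw1, one_mul]
  have e1 : ∑ a, Real.negMulLog (p a) = -∑ a, ∑ b, P a b * Real.log (p a) := by
    rw [← Finset.sum_neg_distrib]
    refine Finset.sum_congr rfl fun a _ => ?_
    rw [← Finset.sum_mul, ← m1, Real.negMulLog, neg_mul]
  have e2 : ∑ a, Real.negMulLog (q a) = -∑ a, ∑ b, P a b * Real.log (q b) := by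
    rw [Finset.sum_comm, ← Finset.sum_neg_distrib]
    refine Finset.sum_congr rfl fun a _ => ?_
    rw [← Finset.sum_mul, ← m2, Real.negMulLog, neg_mul]
  have e3 : ∑ x, Real.negMulLog (law w (fun z => (X z, X' z)) x) =
      -∑ a, ∑ b, P a b * Real.log (P a b) := by
    rw [Fintype.sum_prod_type]
    simp only [Real.negMulLog, neg_mul, Finset.sum_neg_distrib, hP]
  rw [e1, e2, e3]
  linarith

/-- The words of length at most `R`. -/
abbrev WordBall (d R : ℕ) : Type := {v : TreeVertex d // v.1.length ≤ R}

theorem finite_wordBall (d R : ℕ) : {v : TreeVertex d | v.1.length ≤ R}.Finite :=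
  Set.Finite.of_finite_image ((List.finite_length_le (Fin d) R).subset
    (by rintro _ ⟨v, hv, rfl⟩; exact hv)) Subtype.val_injective.injOn

instance (d R : ℕ) : Finite (WordBall d R) := (finite_wordBall d R).to_subtype

noncomputable instance (d R : ℕ) : Fintype (WordBall d R) := Fintype.ofFinite _

/-- The function on the tree that extends `z` by a default value. -/
def extendBall {d R : ℕ} [Inhabited Λ] (z : WordBall d R → Λ) : TreeVertex d → Λ :=
  fun v => if h : v.1.length ≤ R then z ⟨v, h⟩ else default

/-- `Y` depends on the labels of the words of length at most `R` only. -/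
def IsLocal {d : ℕ} {β : Type*} (R : ℕ) (Y : (TreeVertex d → Λ) → β) : Prop :=
  ∀ x y, (∀ v : TreeVertex d, v.1.length ≤ R → x v = y v) → Y x = Y y

/-- If a local rule never puts conflicting values on neighbours, then the probability of a
conflict between independent copies is at most `2 / d` times the entropy of the rule. -/
theorem degree_mul_conflict_le [Inhabited Λ] {d R : ℕ} {w : Λ → ℝ} (hw : ∀ t, 0 ≤ w t)
    (hw1 : ∑ t, w t = 1) {Y : (TreeVertex d → Λ) → A} (hY : IsLocal R Y)
    (K : A → A → Prop) [DecidableRel K]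
    (hK : ∀ x j, ¬ K (Y x) (Y fun v => x (endMulIso j v))) :
    d * ∑ a, ∑ b, (if K a b then law w (fun z : WordBall d R → Λ => Y (extendBall z)) a *
        law w (fun z : WordBall d R → Λ => Y (extendBall z)) b else 0) ≤
      2 * ∑ a, Real.negMulLog (law w (fun z : WordBall d R → Λ => Y (extendBall z)) a) := by
  classical
  obtain ⟨V, _, _, s, hs, hN⟩ := exists_locallyTree d (R + 1)
  set π := law w (fun z : WordBall d R → Λ => Y (extendBall z)) with hπ
  -- Run the rule at `g` by reading the seeds along words from `g`. Short words have distinct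
  -- endpoints, so every vertex carries the same law as in the tree.
  let T : V → (V → Λ) → A := fun g z => Y fun v => z (walkPos s v.1 g)
  have hT : ∀ g h, (∀ u : List (Fin d), u.IsChain (· ≠ ·) → u.length ≤ R → h ≠ walkPos s u g) →
      IgnoresCoord h (T g) := by
    intro g h hh z t
    refine hY _ _ fun v hv => ?_
    exact Function.update_of_ne (Ne.symm (hh v.1 v.2 hv)) _ _
  have hlaw : ∀ g, law w (T g) = π := by
    intro g
    funext a
    have hinj : Function.Injective fun v : WordBall d R => walkPos s v.1.1 g := by
      intro v v' h
      exact Subtype.ext (Subtype.ext (hN g _ _ v.1.2 v'.1.2 (by have := v.2; omega)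
        (by have := v'.2; omega) h))
    have := prodExpect_comp_injective hw1 hinj
      (fun z : WordBall d R → Λ => if Y (extendBall z) = a then (1 : ℝ) else 0)
    rw [hπ, law, law, ← this]
    congr 1
    funext z
    have : T g z = Y (extendBall (R := R) (z ∘ fun v : WordBall d R => walkPos s v.1.1 g)) := by
      refine hY _ _ fun v hv => ?_
      simp [extendBall, hv]
    rw [this]
  have hmain := sum_condEntropy_edge_le hw hw1 hs hN T hT Finset.univ.toList
  simp only [condEntropy_univ hw1, hlaw] at hmain
  have hedge : ∀ g j, ∑ a, ∑ b, (if K a b then π a * π b else 0) ≤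
      ∑ a, Real.negMulLog (π a) + ∑ a, Real.negMulLog (π a) -
        ∑ p, Real.negMulLog (law w (fun z => (T g z, T (s j g) z)) p) := by
    intro g j
    have := conflict_le_mutualInfo hw hw1 (T g) (T (s j g)) K fun z => by
      have := hK (fun v => z (walkPos s v.1 g)) j
      -- Crossing the edge `j` in the finite graph corresponds to the tree automorphism `endMulIso
      -- j`. No other symmetry of the rule is needed.
      have e : (Y fun v => z (walkPos s (endMulIso j v).1 g)) = T (s j g) z := by
        simp only [T]
        congr 1
        funext v
        exact congrArg z (walkPos_endMul hs j v.1 g)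
      rwa [← e]
    rwa [hlaw, hlaw] at this
  have h2 : ∑ g : V, ∑ j : Fin d, ∑ a, ∑ b, (if K a b then π a * π b else 0) ≤
      2 * ∑ g : V, ∑ a, Real.negMulLog (π a) :=
    (Finset.sum_le_sum fun g _ => Finset.sum_le_sum fun j _ => hedge g j).trans hmain
  simp only [Finset.sum_const, Finset.card_univ, Fintype.card_fin, nsmul_eq_mul] at h2
  have hcard : (0 : ℝ) < Fintype.card V := by exact_mod_cast Fintype.card_pos
  refine le_of_mul_le_mul_left ?_ hcard
  linarith

end Conflict

/-! ### Coupled copies with partially resampled labels. -/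

section Copies

variable {B Λ Λ' : Type*} [Fintype B] [DecidableEq B] [Fintype Λ] [Fintype Λ']

theorem prodExpect_prod (w : Λ → ℝ) (w' : Λ' → ℝ) (G : (B → Λ) → (B → Λ') → ℝ) :
    prodExpect (fun t : Λ × Λ' => w t.1 * w' t.2)
      (fun z : B → Λ × Λ' => G (fun v => (z v).1) (fun v => (z v).2)) =
      prodExpect w fun x => prodExpect w' fun y => G x y := by
  simp only [prodExpect, Finset.mul_sum]
  rw [← Fintype.sum_prod_type' (f := fun (x : B → Λ) (y : B → Λ') =>
    (∏ v, w (x v)) * ((∏ v, w' (y v)) * G x y))]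
  rw [← Equiv.sum_comp (Equiv.arrowProdEquivProdArrow B (fun _ => Λ) (fun _ => Λ'))]
  refine Finset.sum_congr rfl fun z _ => ?_
  rw [Finset.prod_mul_distrib]
  simp [mul_assoc]

theorem prodExpect_prod_pi (w : Λ → ℝ) {m : ℕ} (H : Fin m → (B → Λ) → ℝ) :
    prodExpect (fun t : Fin m → Λ => ∏ i, w (t i))
      (fun y : B → Fin m → Λ => ∏ i, H i (fun v => y v i)) = ∏ i, prodExpect w (H i) := by
  simp only [prodExpect]
  rw [Fintype.prod_sum, ← Equiv.sum_comp (Equiv.piComm fun (_ : B) (_ : Fin m) => Λ)]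
  refine Finset.sum_congr rfl fun y _ => ?_
  rw [Finset.prod_mul_distrib, Finset.prod_comm]
  rfl

theorem prodExpect_single [DecidableEq Λ] (t₀ : Λ) (G : (B → Λ) → ℝ) :
    prodExpect (fun t => if t = t₀ then 1 else 0) G = G fun _ => t₀ := by
  rw [prodExpect, Finset.sum_eq_single fun _ => t₀]
  · simp
  · intro z _ hz
    obtain ⟨b, hb⟩ := Function.ne_iff.1 hz
    rw [Finset.prod_eq_zero (Finset.mem_univ b) (if_neg hb), zero_mul]
  · simp

/-- The weights of a coin that shows `true` with probability `p`. -/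
def coinWeight (p : ℝ) (b : Bool) : ℝ := if b then p else 1 - p

/-- The weights of a coin together with a label. -/
def baseWeight (w : Λ → ℝ) (p : ℝ) (t : Bool × Λ) : ℝ := coinWeight p t.1 * w t.2

/-- The label that is resampled if the coin shows `true`. -/
def mixLabel (t : Bool × Λ) (x : Λ) : Λ := if t.1 then x else t.2

/-- The weights of a base label together with `m` fresh labels. -/
def copyWeight (w : Λ → ℝ) (p : ℝ) (m : ℕ) (t : (Bool × Λ) × (Fin m → Λ)) : ℝ :=
  baseWeight w p t.1 * ∏ i, w (t.2 i)

theorem coinWeight_nonneg {p : ℝ} (hp : 0 ≤ p) (hp1 : p ≤ 1) (b : Bool) : 0 ≤ coinWeight p b := by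
  cases b <;> simp [coinWeight, hp, hp1]

theorem sum_coinWeight (p : ℝ) : ∑ b, coinWeight p b = 1 := by simp [coinWeight]

theorem baseWeight_nonneg {w : Λ → ℝ} (hw : ∀ t, 0 ≤ w t) {p : ℝ} (hp : 0 ≤ p) (hp1 : p ≤ 1)
    (t : Bool × Λ) : 0 ≤ baseWeight w p t :=
  mul_nonneg (coinWeight_nonneg hp hp1 _) (hw _)

theorem sum_baseWeight {w : Λ → ℝ} (hw1 : ∑ t, w t = 1) (p : ℝ) : ∑ t, baseWeight w p t = 1 := by
  simp only [baseWeight]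
  rw [Fintype.sum_prod_type, ← Fintype.sum_mul_sum, sum_coinWeight, hw1, one_mul]

theorem copyWeight_nonneg {w : Λ → ℝ} (hw : ∀ t, 0 ≤ w t) {p : ℝ} (hp : 0 ≤ p) (hp1 : p ≤ 1)
    {m : ℕ} (t : (Bool × Λ) × (Fin m → Λ)) : 0 ≤ copyWeight w p m t :=
  mul_nonneg (baseWeight_nonneg hw hp hp1 _) (Finset.prod_nonneg fun _ _ => hw _)

theorem sum_copyWeight {w : Λ → ℝ} (hw1 : ∑ t, w t = 1) (p : ℝ) (m : ℕ) :
    ∑ t, copyWeight w p m t = 1 := by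
  simp only [copyWeight]
  rw [Fintype.sum_prod_type, ← sum_baseWeight hw1 p]
  refine Finset.sum_congr rfl fun t _ => ?_
  dsimp only
  rw [← Finset.mul_sum, sum_prod_weight hw1, mul_one]

/-- The conditional probability that `F` holds, given the base labels, if the labels whose coin
shows `true` are resampled. -/
noncomputable def condProb (w : Λ → ℝ) (F : (B → Λ) → Bool) (ω : B → Bool × Λ) : ℝ :=
  prodExpect w fun x => if F (fun v => mixLabel (ω v) (x v)) then 1 else 0

theorem condProb_nonneg {w : Λ → ℝ} (hw : ∀ t, 0 ≤ w t) (F : (B → Λ) → Bool)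
    (ω : B → Bool × Λ) : 0 ≤ condProb w F ω :=
  prodExpect_nonneg hw fun x => by split_ifs <;> norm_num

theorem condProb_le_one {w : Λ → ℝ} (hw : ∀ t, 0 ≤ w t) (hw1 : ∑ t, w t = 1) (F : (B → Λ) → Bool)
    (ω : B → Bool × Λ) : condProb w F ω ≤ 1 :=
  (prodExpect_mono hw fun x => by split_ifs <;> norm_num).trans (prodExpect_const hw1 1).le

/-- A label that is kept or replaced by a fresh one still has law `w`, so each copy keeps the
density of the rule for every `p`. -/
theorem prodExpect_condProb [DecidableEq Λ] {w : Λ → ℝ} (hw1 : ∑ t, w t = 1)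
    (F : (B → Λ) → Bool) (p : ℝ) :
    prodExpect (baseWeight w p) (condProb w F) = prodExpect w fun x => if F x then 1 else 0 := by
  have h1 := prodExpect_prod (B := B) (baseWeight w p) w
    (fun ω x => if F (fun v => mixLabel (ω v) (x v)) then (1 : ℝ) else 0)
  refine h1.symm.trans ?_
  have h2 := prodExpect_comp_map (B := B) (fun t : (Bool × Λ) × Λ => baseWeight w p t.1 * w t.2)
    (fun t => mixLabel t.1 t.2) (fun x => if F x then 1 else 0)
  refine h2.trans ?_
  congr 1
  funext t'
  simp only [Fintype.sum_prod_type, Fintype.sum_bool, mixLabel, baseWeight, coinWeight, if_true,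
    Bool.false_eq_true, if_false, Finset.sum_ite_eq', Finset.mem_univ]
  rw [Finset.sum_comm (γ := Λ)]
  simp [← Finset.sum_mul, ← Finset.mul_sum, hw1]
  ring

/-- At `p = 0` all labels are shared and the conditional probability is an indicator: one end of the
interpolation in `p`. -/
theorem prodExpect_baseWeight_zero [DecidableEq Λ] {w : Λ → ℝ} (hw1 : ∑ t, w t = 1)
    (F : (B → Λ) → Bool) (g : ℝ → ℝ) :
    prodExpect (baseWeight w 0) (fun ω => g (condProb w F ω)) =
      prodExpect w fun x => g (if F x then 1 else 0) := by
  have h1 := prodExpect_prod (B := B) (coinWeight 0) w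
    (fun b x => g (condProb w F fun v => (b v, x v)))
  refine h1.trans ?_
  have : coinWeight 0 = fun b => if b = false then (1 : ℝ) else 0 := by
    funext b; cases b <;> simp [coinWeight]
  rw [this, prodExpect_single]
  congr 1
  funext x
  simp only [condProb, mixLabel, Bool.false_eq_true, if_false, prodExpect_const hw1]

/-- At `p = 1` all labels are fresh and the conditional probability is constant: the other end of
the interpolation. -/
theorem prodExpect_baseWeight_one [DecidableEq Λ] {w : Λ → ℝ} (hw1 : ∑ t, w t = 1)
    (F : (B → Λ) → Bool) (g : ℝ → ℝ) :
    prodExpect (baseWeight w 1) (fun ω => g (condProb w F ω)) =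
      g (prodExpect w fun x => if F x then 1 else 0) := by
  have h1 := prodExpect_prod (B := B) (coinWeight 1) w
    (fun b x => g (condProb w F fun v => (b v, x v)))
  refine h1.trans ?_
  have : coinWeight 1 = fun b => if b = true then (1 : ℝ) else 0 := by
    funext b; cases b <;> simp [coinWeight]
  rw [this, prodExpect_single]
  simp only [condProb, mixLabel, if_true, prodExpect_const hw1]

theorem continuous_prodExpect_baseWeight (w : Λ → ℝ) (G : (B → Bool × Λ) → ℝ) :
    Continuous fun p => prodExpect (baseWeight w p) G := by
  unfold prodExpect
  refine continuous_finsetSum _ fun z _ => Continuous.mul (continuous_finsetProd _ fun v _ => ?_)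
    continuous_const
  unfold baseWeight coinWeight
  refine Continuous.mul ?_ continuous_const
  split_ifs <;> fun_prop

/-- The joint law of `m` copies. -/
theorem law_copies {w : Λ → ℝ} (hw1 : ∑ t, w t = 1) (F : (B → Λ) → Bool)
    (p : ℝ) (m : ℕ) (σ : Fin m → Bool) :
    law (copyWeight w p m)
      (fun (z : B → (Bool × Λ) × (Fin m → Λ)) i => F fun v => mixLabel (z v).1 ((z v).2 i)) σ =
      prodExpect (baseWeight w p) fun ω => ∏ i, coinWeight (condProb w F ω) (σ i) := by
  have h1 := prodExpect_prod (B := B) (baseWeight w p) (fun t : Fin m → Λ => ∏ i, w (t i))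
    (fun ω y => ∏ i, if F (fun v => mixLabel (ω v) (y v i)) = σ i then (1 : ℝ) else 0)
  have h2 : law (copyWeight w p m)
      (fun (z : B → (Bool × Λ) × (Fin m → Λ)) i => F fun v => mixLabel (z v).1 ((z v).2 i)) σ =
      prodExpect (copyWeight w p m) fun z =>
        ∏ i, if F (fun v => mixLabel (z v).1 ((z v).2 i)) = σ i then (1 : ℝ) else 0 := by
    rw [law]
    congr 1
    funext z
    rw [Finset.prod_ite_zero]
    simp [funext_iff]
  refine h2.trans (h1.trans ?_)
  congr 1
  funext ω
  have h3 := prodExpect_prod_pi (B := B) w fun (i : Fin m) (x : B → Λ) =>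
    if F (fun v => mixLabel (ω v) (x v)) = σ i then (1 : ℝ) else 0
  refine h3.trans (Finset.prod_congr rfl fun i _ => ?_)
  cases σ i
  · rw [coinWeight, if_neg (by simp), condProb, ← prodExpect_const (V := B) hw1 1, ← prodExpect_sub]
    congr 1
    funext x
    cases F fun v => mixLabel (ω v) (x v) <;> simp [prodExpect_const hw1]
  · rw [coinWeight, if_pos rfl, condProb]

/-- The positions are independent, and each avoids a double `true` with factor `1 - x * y`; the sum
is the complement of avoiding it everywhere. -/
theorem sum_conflict_coin (m : ℕ) (x y : ℝ) :
    ∑ σ : Fin m → Bool, ∑ τ : Fin m → Bool, (if ∃ i, σ i = true ∧ τ i = true then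
      (∏ i, coinWeight x (σ i)) * ∏ i, coinWeight y (τ i) else 0) = 1 - (1 - x * y) ^ m := by
  have h1 : ∀ z : ℝ, ∑ σ : Fin m → Bool, ∏ i, coinWeight z (σ i) = 1 := fun z =>
    sum_prod_weight (sum_coinWeight z)
  have h2 : ∑ σ : Fin m → Bool, ∑ τ : Fin m → Bool,
      ∏ i, (if σ i = true ∧ τ i = true then 0 else coinWeight x (σ i) * coinWeight y (τ i)) =
      (1 - x * y) ^ m := by
    calc _ = ∑ σ : Fin m → Bool, ∏ i, ∑ b, (if σ i = true ∧ b = true then 0 else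
          coinWeight x (σ i) * coinWeight y b) := by
          simp only [Fintype.prod_sum]
      _ = ∏ i : Fin m, ∑ a, ∑ b, (if a = true ∧ b = true then 0 else
          coinWeight x a * coinWeight y b) := by
          rw [Fintype.prod_sum]
      _ = _ := by
          simp [coinWeight]
          congr 1
          ring
  have h3 : (1 : ℝ) = (∑ σ : Fin m → Bool, ∏ i, coinWeight x (σ i)) *
      ∑ τ : Fin m → Bool, ∏ i, coinWeight y (τ i) := by rw [h1, h1, one_mul]
  rw [← h2, h3, Finset.sum_mul_sum, ← Finset.sum_sub_distrib]
  refine Finset.sum_congr rfl fun σ _ => ?_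
  rw [← Finset.sum_sub_distrib]
  refine Finset.sum_congr rfl fun τ _ => ?_
  by_cases h : ∃ i, σ i = true ∧ τ i = true
  · obtain ⟨i, hi⟩ := h
    have h0 : ∏ i, (if σ i = true ∧ τ i = true then 0 else coinWeight x (σ i) *
        coinWeight y (τ i)) = 0 := Finset.prod_eq_zero (Finset.mem_univ i) (if_pos hi)
    rw [if_pos ⟨i, hi⟩, h0, sub_zero]
  · rw [if_neg h, ← Finset.prod_mul_distrib, eq_comm, sub_eq_zero]
    exact Finset.prod_congr rfl fun i _ => (if_neg fun hi => h ⟨i, hi⟩).symm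

/-- Compare `π` with reference weights, namely `1` at `a₀` and `u / card A` at every other value.
For `m` copies `a₀` is the pattern in which no copy is chosen. -/
theorem sum_negMulLog_le {A : Type*} [Fintype A] [DecidableEq A] {π : A → ℝ} (hπ : ∀ a, 0 ≤ π a)
    (hπ1 : ∑ a, π a = 1) (a₀ : A) {u : ℝ} (hu : u = 1 - π a₀) (hu0 : 0 < u) :
    ∑ a, Real.negMulLog (π a) ≤ u * (-Real.log u + Real.log (Fintype.card A) + 1) := by
  have hn : (0 : ℝ) < Fintype.card A := by
    have : Nonempty A := ⟨a₀⟩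
    exact_mod_cast Fintype.card_pos
  set n : ℝ := (Fintype.card A : ℝ)
  have key : ∀ x y : ℝ, 0 ≤ x → 0 < y → Real.negMulLog x ≤ -(x * Real.log y) + y - x := by
    intro x y hx hy
    rcases hx.eq_or_lt with rfl | hx
    · simp [hy.le]
    · have h1 := Real.log_le_sub_one_of_pos (x := y / x) (by positivity)
      rw [Real.log_div hy.ne' hx.ne'] at h1
      have h2 := mul_le_mul_of_nonneg_left h1 hx.le
      have h3 : x * (y / x - 1) = y - x := by field_simp
      rw [h3] at h2
      rw [Real.negMulLog]; linarith
  have hsum : ∑ a ∈ Finset.univ.erase a₀, π a = u := by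
    rw [hu, ← hπ1, ← Finset.add_sum_erase _ _ (Finset.mem_univ a₀)]; ring
  have hcard : ((Finset.univ.erase a₀).card : ℝ) ≤ n := by
    exact Nat.cast_le.2 (Finset.card_le_univ _)
  rw [← Finset.add_sum_erase _ _ (Finset.mem_univ a₀)]
  have h1 : Real.negMulLog (π a₀) ≤ u := by
    have := key (π a₀) 1 (hπ a₀) one_pos
    rw [Real.log_one] at this
    linarith
  have h2 : ∑ a ∈ Finset.univ.erase a₀, Real.negMulLog (π a) ≤
      ∑ a ∈ Finset.univ.erase a₀, (-(π a * Real.log (u / n)) + u / n - π a) :=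
    Finset.sum_le_sum fun a _ => key _ _ (hπ a) (by positivity)
  rw [Finset.sum_sub_distrib, Finset.sum_add_distrib, Finset.sum_neg_distrib, ← Finset.sum_mul,
    hsum, Finset.sum_const, nsmul_eq_mul, Real.log_div hu0.ne' hn.ne'] at h2
  have h3 : ((Finset.univ.erase a₀).card : ℝ) * (u / n) ≤ u := by
    calc _ ≤ n * (u / n) := by gcongr
      _ = u := by field_simp
  linarith

/-- The conflict inequality for `m` copies that share the labels whose coin shows `false`. -/
theorem degree_mul_copies_le [DecidableEq Λ] [Inhabited Λ] {d R : ℕ} {w : Λ → ℝ}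
    (hw : ∀ t, 0 ≤ w t) (hw1 : ∑ t, w t = 1) {F : (TreeVertex d → Λ) → Bool} (hF : IsLocal R F)
    (hind : ∀ x j, ¬ (F x = true ∧ F (fun v => x (endMulIso j v)) = true))
    {p : ℝ} (hp : 0 ≤ p) (hp1 : p ≤ 1) (m : ℕ) {u : ℝ}
    (hu : u = prodExpect (baseWeight w p) fun ω =>
      1 - (1 - condProb w (fun z : WordBall d R → Λ => F (extendBall z)) ω) ^ m)
    (hu0 : 0 < u) :
    d * prodExpect (baseWeight w p) (fun ω => prodExpect (baseWeight w p) fun ω' =>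
      1 - (1 - condProb w (fun z : WordBall d R → Λ => F (extendBall z)) ω *
        condProb w (fun z : WordBall d R → Λ => F (extendBall z)) ω') ^ m) ≤
      2 * (u * (-Real.log u + m * Real.log 2 + 1)) := by
  set F' : (WordBall d R → Λ) → Bool := fun z => F (extendBall z) with hF'
  -- The vector of copies is itself a local rule over an enlarged alphabet. Two vectors conflict if
  -- some copy is chosen in both.
  let Y : (TreeVertex d → (Bool × Λ) × (Fin m → Λ)) → Fin m → Bool :=
    fun x i => F fun v => mixLabel (x v).1 ((x v).2 i)
  have hY : IsLocal R Y := by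
    intro x y hxy
    funext i
    exact hF _ _ fun v hv => by simp only [hxy v hv]
  have hlaw : law (copyWeight w p m)
      (fun z : WordBall d R → (Bool × Λ) × (Fin m → Λ) => Y (extendBall z)) =
      fun σ => prodExpect (baseWeight w p) fun ω => ∏ i, coinWeight (condProb w F' ω) (σ i) := by
    funext σ
    rw [← law_copies hw1]
    congr 1
    funext z i
    refine hF _ _ fun v hv => ?_
    simp [extendBall, hv]
  have hmain := degree_mul_conflict_le (copyWeight_nonneg hw hp hp1) (sum_copyWeight hw1 p m) hY
    (fun σ τ => ∃ i, σ i = true ∧ τ i = true) (by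
      rintro x j ⟨i, hi⟩
      exact hind (fun v => mixLabel (x v).1 ((x v).2 i)) j hi)
  rw [hlaw] at hmain
  have hbw1 := sum_baseWeight hw1 p
  have hent := sum_negMulLog_le (u := u)
    (π := fun σ : Fin m → Bool =>
      prodExpect (baseWeight w p) fun ω => ∏ i, coinWeight (condProb w F' ω) (σ i))
    (fun σ => by rw [← congrFun hlaw σ]; exact law_nonneg (copyWeight_nonneg hw hp hp1) _ _)
    (by simp only [← congrFun hlaw]; exact sum_law (sum_copyWeight hw1 p m) _)
    (fun _ => false) (by
      rw [hu, prodExpect_sub, prodExpect_const hbw1]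
      simp [coinWeight]) hu0
  have hconf : ∑ σ : Fin m → Bool, ∑ τ : Fin m → Bool, (if ∃ i, σ i = true ∧ τ i = true then
      (prodExpect (baseWeight w p) fun ω => ∏ i, coinWeight (condProb w F' ω) (σ i)) *
      (prodExpect (baseWeight w p) fun ω => ∏ i, coinWeight (condProb w F' ω) (τ i)) else 0) =
      prodExpect (baseWeight w p) (fun ω => prodExpect (baseWeight w p) fun ω' =>
        1 - (1 - condProb w F' ω * condProb w F' ω') ^ m) := by
    simp only [← sum_conflict_coin, prodExpect_finsetSum]
    refine Finset.sum_congr rfl fun σ _ => Finset.sum_congr rfl fun τ _ => ?_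
    split_ifs with h
    · rw [mul_comm, ← prodExpect_const_mul]
      congr 1
      funext ω
      rw [mul_comm, ← prodExpect_const_mul]
    · simp [prodExpect_const hbw1]
  rw [hconf] at hmain
  have hcard : Real.log (Fintype.card (Fin m → Bool)) = m * Real.log 2 := by
    simp
  rw [hcard] at hent
  linarith

end Copies

/-! ### Geometric averaging over the number of copies. -/

section Averaging

/-- After multiplication by `1 + δ` the averaged function fixes 0 and 1 and has slope `(1 + δ) / δ`
at 0, so it enlarges small conditional probabilities and leaves indicators alone. -/
theorem hasSum_geometric_copies {δ x : ℝ} (hδ : 0 < δ) (hx : 0 ≤ x) (hx1 : x ≤ 1) :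
    HasSum (fun m : ℕ => δ / (1 + δ) * (1 / (1 + δ)) ^ m * (1 - (1 - x) ^ m)) (x / (x + δ)) := by
  have h1 : HasSum (fun m : ℕ => (1 / (1 + δ)) ^ m) (1 - 1 / (1 + δ))⁻¹ :=
    hasSum_geometric_of_lt_one (by positivity) (by rw [div_lt_one (by linarith)]; linarith)
  have h2 : HasSum (fun m : ℕ => (1 / (1 + δ) * (1 - x)) ^ m) (1 - 1 / (1 + δ) * (1 - x))⁻¹ := by
    refine hasSum_geometric_of_lt_one (mul_nonneg (by positivity) (by linarith)) ?_
    rw [one_div, inv_mul_lt_iff₀ (by linarith)]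
    linarith
  have h3 := (h1.sub h2).mul_left (δ / (1 + δ))
  have e0 : (fun m : ℕ => δ / (1 + δ) * (1 / (1 + δ)) ^ m * (1 - (1 - x) ^ m)) = fun m =>
      δ / (1 + δ) * ((1 / (1 + δ)) ^ m - (1 / (1 + δ) * (1 - x)) ^ m) := by
    funext m
    rw [mul_pow]; ring
  have e1 : 1 - 1 / (1 + δ) = δ / (1 + δ) := by field_simp; ring
  have e2 : 1 - 1 / (1 + δ) * (1 - x) = (x + δ) / (1 + δ) := by field_simp; ring
  have hxδ : 0 < x + δ := by linarith
  have e3 : x / (x + δ) = δ / (1 + δ) * ((1 - 1 / (1 + δ))⁻¹ -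
      (1 - 1 / (1 + δ) * (1 - x))⁻¹) := by
    rw [e1, e2]
    field_simp
    ring
  rw [e0, e3]
  exact h3

theorem summable_geometric_sq {δ : ℝ} (hδ : 0 < δ) :
    Summable fun m : ℕ => δ / (1 + δ) * (1 / (1 + δ)) ^ m * (m : ℝ) ^ 2 := by
  have h := summable_pow_mul_geometric_of_norm_lt_one (R := ℝ) 2 (r := 1 / (1 + δ)) (by
    rw [Real.norm_of_nonneg (by positivity), div_lt_one (by linarith)]; linarith)
  refine (h.mul_left (δ / (1 + δ))).congr fun m => ?_
  ring

variable {ι : Type*} [Fintype ι]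

/-- For `m ≥ 1` one has `ρ ≤ u ≤ m * ρ`. The lower bound replaces `log u` by `log ρ`, and the upper
bound turns `u * m` into `ρ * m²`, whose geometric average is finite. Thus the main term is linear
in the averaged `u`. -/
theorem geometric_average_conflict_le {W Q : ι → ℝ} (hW : ∀ i, 0 ≤ W i)
    (hQ : ∀ i, 0 ≤ Q i) (hQ1 : ∀ i, Q i ≤ 1) {ρ : ℝ} (hρ : ∑ i, W i * Q i = ρ) (hρ0 : 0 < ρ)
    {D δ : ℝ} (hδ : 0 < δ)
    (H : ∀ (m : ℕ) (u : ℝ), u = ∑ i, W i * (1 - (1 - Q i) ^ m) → 0 < u →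
      D * ∑ i, W i * ∑ j, W j * (1 - (1 - Q i * Q j) ^ m) ≤
        2 * (u * (-Real.log u + m * Real.log 2 + 1))) :
    D * ∑ i, W i * ∑ j, W j * (Q i * Q j / (Q i * Q j + δ)) ≤
      2 * ((-Real.log ρ + 1) * ∑ i, W i * (Q i / (Q i + δ)) +
        ρ * Real.log 2 * ∑' m : ℕ, δ / (1 + δ) * (1 / (1 + δ)) ^ m * (m : ℝ) ^ 2) := by
  set g : ℕ → ℝ := fun m => δ / (1 + δ) * (1 / (1 + δ)) ^ m with hg
  have hg0 : ∀ m, 0 ≤ g m := fun m => by positivity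
  have s1 : HasSum (fun m => D * ∑ i, W i * ∑ j, W j * (g m * (1 - (1 - Q i * Q j) ^ m)))
      (D * ∑ i, W i * ∑ j, W j * (Q i * Q j / (Q i * Q j + δ))) := by
    refine (hasSum_sum fun i _ => (hasSum_sum fun j _ => ?_).mul_left _).mul_left _
    exact (hasSum_geometric_copies hδ (mul_nonneg (hQ i) (hQ j))
      (mul_le_one₀ (hQ1 i) (hQ j) (hQ1 j))).mul_left _
  have s2 : HasSum (fun m => 2 * ((-Real.log ρ + 1) * (∑ i, W i * (g m * (1 - (1 - Q i) ^ m))) +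
      ρ * Real.log 2 * (g m * (m : ℝ) ^ 2))) _ :=
    ((HasSum.mul_left (-Real.log ρ + 1) (hasSum_sum fun i _ =>
      (hasSum_geometric_copies hδ (hQ i) (hQ1 i)).mul_left (W i))).add
      ((summable_geometric_sq hδ).hasSum.mul_left (ρ * Real.log 2))).mul_left 2
  refine hasSum_le (fun m => ?_) s1 s2
  rcases Nat.eq_zero_or_pos m with rfl | hm
  · simp
  set u := ∑ i, W i * (1 - (1 - Q i) ^ m) with hu
  have hρu : ρ ≤ u := by
    rw [← hρ]
    refine Finset.sum_le_sum fun i _ => mul_le_mul_of_nonneg_left ?_ (hW i)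
    have : (1 - Q i) ^ m ≤ 1 - Q i :=
      pow_le_of_le_one (by linarith [hQ1 i]) (by linarith [hQ i]) hm.ne'
    linarith
  have hum : u ≤ m * ρ := by
    rw [← hρ, Finset.mul_sum]
    refine Finset.sum_le_sum fun i _ => ?_
    rw [mul_left_comm]
    refine mul_le_mul_of_nonneg_left ?_ (hW i)
    have := one_add_mul_le_pow (a := -Q i) (by linarith [hQ1 i]) m
    rw [← sub_eq_add_neg] at this
    linarith
  have hu0 : 0 < u := hρ0.trans_le hρu
  have h1 := mul_le_mul_of_nonneg_left (H m u hu hu0) (hg0 m)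
  have hlog : Real.log ρ ≤ Real.log u := Real.log_le_log hρ0 hρu
  have hl2 : 0 ≤ Real.log 2 := Real.log_nonneg (by norm_num)
  have h2 : u * (-Real.log u + m * Real.log 2 + 1) ≤
      (-Real.log ρ + 1) * u + ρ * Real.log 2 * (m : ℝ) ^ 2 := by
    have a1 : u * (-Real.log u) ≤ u * (-Real.log ρ) := by gcongr
    have a2 : u * (m * Real.log 2) ≤ m * ρ * (m * Real.log 2) := by gcongr
    nlinarith
  have h3 := mul_le_mul_of_nonneg_left h2 (mul_nonneg zero_le_two (hg0 m))
  have e1 : ∑ i, W i * ∑ j, W j * (g m * (1 - (1 - Q i * Q j) ^ m)) =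
      g m * ∑ i, W i * ∑ j, W j * (1 - (1 - Q i * Q j) ^ m) := by
    simp only [Finset.mul_sum, mul_left_comm (g m)]
  have e2 : ∑ i, W i * (g m * (1 - (1 - Q i) ^ m)) = g m * u := by
    simp only [hu, Finset.mul_sum, mul_left_comm (g m)]
  rw [e1, e2]
  linarith

/-- With `φ x = (1 + δ) x / (x + δ)` the left side is bilinear in the pairs `(x, φ x)` and `(y, φ
y)`, so its mean over independent `x`, `y` depends only on the means of `Q` and `φ Q`. The
difference of the two sides factors into nonnegative terms. -/
theorem overlap_lower_bound {δ x y : ℝ} (hδ : 0 < δ) (hx : 0 ≤ x) (hx1 : x ≤ 1) (hy : 0 ≤ y)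
    (hy1 : y ≤ 1) :
    y * ((1 + δ) * (x / (x + δ))) + x * ((1 + δ) * (y / (y + δ))) - x * y -
      δ * (((1 + δ) * (x / (x + δ)) - x) * ((1 + δ) * (y / (y + δ)) - y)) ≤
      (1 + δ) * (x * y / (x * y + δ)) := by
  have h1 : 0 < x + δ := by linarith
  have h2 : 0 < y + δ := by linarith
  have h3 : 0 < x * y + δ := by positivity
  rw [← sub_nonneg]
  have : (1 + δ) * (x * y / (x * y + δ)) - (y * ((1 + δ) * (x / (x + δ))) +
      x * ((1 + δ) * (y / (y + δ))) - x * y -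
      δ * (((1 + δ) * (x / (x + δ)) - x) * ((1 + δ) * (y / (y + δ)) - y))) =
      x * y * ((1 + δ) * (x * (1 - x) * (y * (1 - y)))) / ((x + δ) * (y + δ) * (x * y + δ)) := by
    field_simp
    ring
  rw [this]
  have : 0 ≤ 1 - x := by linarith
  have : 0 ≤ 1 - y := by linarith
  positivity

/-- The means `ρ` of `Q` and `Mρ` of `φ Q` give averaged conflict at least `ρ² (2M - 1 - δ (M -
1)²)`. The choice `δ = 1/M²` keeps the quadratic loss at most one. The entropy side is `2Mρ (-log
ρ)` up to `O_M(ρ)`, and division by `2Mρ` leaves the factor `1 - 1/M`. -/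
theorem degree_mul_density_le_of_overlap {W Q : ι → ℝ} (hW : ∀ i, 0 ≤ W i)
    (hQ : ∀ i, 0 ≤ Q i) (hQ1 : ∀ i, Q i ≤ 1) {ρ : ℝ} (hρ : ∑ i, W i * Q i = ρ) (hρ0 : 0 < ρ)
    {D M : ℝ} (hD : 0 ≤ D) (hM : 1 < M)
    (hMρ : ∑ i, W i * ((1 + 1 / M ^ 2) * (Q i / (Q i + 1 / M ^ 2))) = M * ρ)
    (H : ∀ (m : ℕ) (u : ℝ), u = ∑ i, W i * (1 - (1 - Q i) ^ m) → 0 < u →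
      D * ∑ i, W i * ∑ j, W j * (1 - (1 - Q i * Q j) ^ m) ≤
        2 * (u * (-Real.log u + m * Real.log 2 + 1))) :
    D * ρ * (1 - 1 / M) ≤ -Real.log ρ + (1 + 2 * Real.log 2 * ∑' m : ℕ, (1 / M ^ 2) /
      (1 + 1 / M ^ 2) * (1 / (1 + 1 / M ^ 2)) ^ m * (m : ℝ) ^ 2) := by
  have hM0 : 0 < M := by linarith
  set δ := 1 / M ^ 2 with hδd
  have hδ : 0 < δ := by positivity
  have hδ1 : δ ≤ 1 := by
    rw [hδd, div_le_one (by positivity)]; exact one_le_pow₀ hM.le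
  have hmain := geometric_average_conflict_le hW hQ hQ1 hρ hρ0 hδ H
  set S := ∑' m : ℕ, δ / (1 + δ) * (1 / (1 + δ)) ^ m * (m : ℝ) ^ 2 with hS
  have hS0 : 0 ≤ S := tsum_nonneg fun m => by positivity
  set G : ι → ℝ := fun i => (1 + δ) * (Q i / (Q i + δ)) with hG
  have e1 : (1 + δ) * ∑ i, W i * ∑ j, W j * (Q i * Q j / (Q i * Q j + δ)) ≥
      ∑ i, W i * ∑ j, W j * (Q j * G i + Q i * G j - Q i * Q j -
        δ * ((G i - Q i) * (G j - Q j))) := by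
    simp only [Finset.mul_sum]
    refine Finset.sum_le_sum fun i _ => Finset.sum_le_sum fun j _ => ?_
    have := mul_le_mul_of_nonneg_left (overlap_lower_bound hδ (hQ i) (hQ1 i) (hQ j) (hQ1 j))
      (mul_nonneg (hW i) (hW j))
    simp only [hG]
    linarith
  have sG : ∑ i, W i * (G i - Q i) = M * ρ - ρ := by
    simp only [mul_sub, Finset.sum_sub_distrib]
    rw [hρ, ← hMρ]
  have e2 : ∑ i, W i * ∑ j, W j * (Q j * G i + Q i * G j - Q i * Q j -
        δ * ((G i - Q i) * (G j - Q j))) =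
      ρ ^ 2 * (2 * M - 1 - δ * (M - 1) ^ 2) := by
    have inner : ∀ i, ∑ j, W j * (Q j * G i + Q i * G j - Q i * Q j -
        δ * ((G i - Q i) * (G j - Q j))) =
        ρ * G i + M * ρ * Q i - ρ * Q i - δ * (M * ρ - ρ) * (G i - Q i) := by
      intro i
      have a1 : ρ * G i = ∑ j, W j * (Q j * G i) := by
        rw [← hρ, Finset.sum_mul]; exact Finset.sum_congr rfl fun j _ => by ring
      have a2 : M * ρ * Q i = ∑ j, W j * (Q i * G j) := by
        rw [← hMρ, Finset.sum_mul]; exact Finset.sum_congr rfl fun j _ => by simp only [hG]; ring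
      have a3 : ρ * Q i = ∑ j, W j * (Q i * Q j) := by
        rw [← hρ, Finset.sum_mul]; exact Finset.sum_congr rfl fun j _ => by ring
      have a4 : δ * (M * ρ - ρ) * (G i - Q i) = ∑ j, W j * (δ * ((G i - Q i) * (G j - Q j))) := by
        rw [← sG, Finset.mul_sum, Finset.sum_mul]
        exact Finset.sum_congr rfl fun j _ => by ring
      rw [a1, a2, a3, a4, ← Finset.sum_add_distrib, ← Finset.sum_sub_distrib,
        ← Finset.sum_sub_distrib]
      exact Finset.sum_congr rfl fun j _ => by ring
    have outer : ∑ i, W i * (ρ * G i + M * ρ * Q i - ρ * Q i - δ * (M * ρ - ρ) * (G i - Q i)) =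
        ρ * ∑ i, W i * G i + M * ρ * ∑ i, W i * Q i - ρ * ∑ i, W i * Q i -
          δ * (M * ρ - ρ) * ∑ i, W i * (G i - Q i) := by
      simp only [Finset.mul_sum]
      rw [← Finset.sum_add_distrib, ← Finset.sum_sub_distrib, ← Finset.sum_sub_distrib]
      exact Finset.sum_congr rfl fun j _ => by ring
    simp only [inner]
    rw [outer, sG, hρ, hMρ]
    ring
  rw [e2] at e1
  have e3 : (1 + δ) * ∑ i, W i * (Q i / (Q i + δ)) = M * ρ := by
    rw [← hMρ, Finset.mul_sum]; exact Finset.sum_congr rfl fun j _ => by ring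
  have e4 : δ * (M - 1) ^ 2 ≤ 1 := by
    rw [hδd, div_mul_eq_mul_div, one_mul, div_le_one (by positivity)]
    exact pow_le_pow_left₀ (by linarith) (by linarith) 2
  have f1 : D * (ρ ^ 2 * (2 * M - 2)) ≤ D * (ρ ^ 2 * (2 * M - 1 - δ * (M - 1) ^ 2)) :=
    mul_le_mul_of_nonneg_left (mul_le_mul_of_nonneg_left (by linarith) (sq_nonneg ρ)) hD
  have f2 : D * (ρ ^ 2 * (2 * M - 1 - δ * (M - 1) ^ 2)) ≤
      2 * ((-Real.log ρ + 1) * (M * ρ) + (1 + δ) * (ρ * Real.log 2 * S)) := by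
    have g1 := mul_le_mul_of_nonneg_left e1 hD
    have g2 := mul_le_mul_of_nonneg_left hmain (by linarith : 0 ≤ 1 + δ)
    rw [← e3]
    linarith
  have hl2 : 0 ≤ Real.log 2 := Real.log_nonneg (by norm_num)
  have f3 : (1 + δ) * (ρ * Real.log 2 * S) ≤ 2 * M * (ρ * Real.log 2 * S) := by
    have : 0 ≤ ρ * Real.log 2 * S := by positivity
    gcongr; linarith
  have f4 : (2 * M * ρ) * (D * ρ * (1 - 1 / M)) ≤
      (2 * M * ρ) * (-Real.log ρ + (1 + 2 * Real.log 2 * S)) := by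
    have : (2 * M * ρ) * (D * ρ * (1 - 1 / M)) = D * (ρ ^ 2 * (2 * M - 2)) := by
      field_simp
    rw [this]
    linarith
  exact le_of_mul_le_mul_left f4 (by positivity)

end Averaging

/-! ### The density bound for local rules. -/

section LocalRules

variable {Λ : Type*} [Fintype Λ] [DecidableEq Λ] [Inhabited Λ]

/-- The probability that a local rule of range `R` puts the root into its set. -/
noncomputable def localDensity {d : ℕ} (w : Λ → ℝ) (R : ℕ) (F : (TreeVertex d → Λ) → Bool) : ℝ :=
  prodExpect w fun z : WordBall d R → Λ => if F (extendBall z) then 1 else 0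

/-- A single copy without resampling. It loses a factor two, but it suffices to make the density
small when `d` is large. -/
theorem degree_mul_localDensity_le_crude {d R : ℕ} {w : Λ → ℝ}
    (hw : ∀ t, 0 ≤ w t) (hw1 : ∑ t, w t = 1) {F : (TreeVertex d → Λ) → Bool} (hF : IsLocal R F)
    (hind : ∀ x j, ¬ (F x = true ∧ F (fun v => x (endMulIso j v)) = true))
    (hρ : 0 < localDensity w R F) :
    d * localDensity w R F ≤ 2 * (-Real.log (localDensity w R F) + 2) := by
  set ρ := localDensity w R F with hρd
  set F' : (WordBall d R → Λ) → Bool := fun z => F (extendBall z) with hF'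
  have hE := prodExpect_condProb hw1 F' 0
  change _ = ρ at hE
  have h := degree_mul_copies_le hw hw1 hF hind le_rfl zero_le_one 1 (u := ρ)
    (by simp only [pow_one, sub_sub_cancel]; exact hE.symm) hρ
  simp only [pow_one, sub_sub_cancel] at h
  have e : prodExpect (baseWeight w 0) (fun ω => prodExpect (baseWeight w 0) fun ω' =>
      condProb w F' ω * condProb w F' ω') = ρ * ρ := by
    simp only [prodExpect_const_mul, hE]
    rw [← hE, ← prodExpect_const_mul, hE]
    simp only [mul_comm]
  rw [e] at h
  have hl2 : Real.log 2 ≤ 1 := by have := Real.log_two_lt_d9; linarith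
  refine le_of_mul_le_mul_left (a := ρ) ?_ hρ
  push_cast at h
  nlinarith

theorem degree_mul_localDensity_le {d R : ℕ} {w : Λ → ℝ}
    (hw : ∀ t, 0 ≤ w t) (hw1 : ∑ t, w t = 1) {F : (TreeVertex d → Λ) → Bool} (hF : IsLocal R F)
    (hind : ∀ x j, ¬ (F x = true ∧ F (fun v => x (endMulIso j v)) = true))
    (hρ : 0 < localDensity w R F) {M : ℝ} (hM : 1 < M)
    (hρM : localDensity w R F ≤ 1 / M - 1 / M ^ 2) :
    d * localDensity w R F * (1 - 1 / M) ≤ -Real.log (localDensity w R F) +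
      (1 + 2 * Real.log 2 * ∑' m : ℕ, (1 / M ^ 2) /
      (1 + 1 / M ^ 2) * (1 / (1 + 1 / M ^ 2)) ^ m * (m : ℝ) ^ 2) := by
  have hM0 : 0 < M := by linarith
  set ρ := localDensity w R F with hρd
  set F' : (WordBall d R → Λ) → Bool := fun z => F (extendBall z) with hF'
  set δ := 1 / M ^ 2 with hδd
  have hδ : 0 < δ := by positivity
  let φ : ℝ → ℝ := fun x => (1 + δ) * (x / (x + δ))
  have hcont : Continuous fun p => prodExpect (baseWeight w p) fun ω => φ (condProb w F' ω) :=
    continuous_prodExpect_baseWeight w _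
  have h0 : (prodExpect (baseWeight w 0) fun ω => φ (condProb w F' ω)) = ρ := by
    rw [prodExpect_baseWeight_zero hw1, hρd, localDensity]
    congr 1
    funext z
    cases h : F' z
    · simp only [φ, hF'] at h ⊢; simp [h]
    · simp only [φ, hF'] at h ⊢
      simp only [h, if_true]
      field_simp
  have h1 : (prodExpect (baseWeight w 1) fun ω => φ (condProb w F' ω)) = φ ρ :=
    prodExpect_baseWeight_one hw1 F' φ
  -- The smallness of `ρ` says exactly that `M * (ρ + δ) ≤ 1`.
  have hφ : M * ρ ≤ φ ρ := by
    have : M * (ρ + δ) ≤ 1 + δ := by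
      have : M * (ρ + δ) ≤ M * (1 / M - 1 / M ^ 2 + δ) := by gcongr
      have e : M * (1 / M - 1 / M ^ 2 + δ) = 1 := by rw [hδd]; field_simp; ring
      linarith
    have h2 : φ ρ = (1 + δ) * ρ / (ρ + δ) := by simp only [φ]; ring
    rw [h2, le_div_iff₀ (by linarith)]
    nlinarith
  -- The mean of `φ Q` runs from `ρ` to `φ ρ`, hence takes the value `M * ρ` in between.
  obtain ⟨p, ⟨hp0, hp1⟩, hp⟩ := intermediate_value_Icc (zero_le_one (α := ℝ)) hcont.continuousOn
    (⟨by rw [h0]; nlinarith, by rw [h1]; exact hφ⟩ : M * ρ ∈ Set.Icc _ _)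
  refine degree_mul_density_le_of_overlap (W := fun ω : WordBall d R → Bool × Λ =>
      ∏ v, baseWeight w p (ω v)) (Q := condProb w F')
    (fun ω => Finset.prod_nonneg fun v _ => baseWeight_nonneg hw hp0 hp1 _)
    (condProb_nonneg hw F')
    (condProb_le_one hw hw1 F') (prodExpect_condProb hw1 F' p) hρ (Nat.cast_nonneg d) hM hp ?_
  intro m u hu hu0
  exact degree_mul_copies_le hw hw1 hF hind hp0 hp1 m hu hu0

theorem exists_localDensity_bound {ε : ℝ} (hε : 0 < ε) : ∃ D : ℕ, ∀ d : ℕ, D < d →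
    ∀ (Λ : Type) [Fintype Λ] [DecidableEq Λ] [Inhabited Λ] (w : Λ → ℝ), (∀ t, 0 ≤ w t) →
    ∑ t, w t = 1 → ∀ (R : ℕ) (F : (TreeVertex d → Λ) → Bool), IsLocal R F →
    (∀ x j, ¬ (F x = true ∧ F (fun v => x (endMulIso j v)) = true)) →
    localDensity w R F ≤ (1 + ε) * (Real.log d / d) := by
  -- Chosen so that `(1 + ε) * (1 - 1 / M) = 1 + ε / 2`; the spare `ε / 2 * log d` absorbs the
  -- constant `C`.
  set M : ℝ := 2 * (1 + ε) / ε with hMd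
  have hM : 1 < M := by rw [hMd, lt_div_iff₀ hε]; linarith
  have hM0 : 0 < M := by linarith
  set C := 1 + 2 * Real.log 2 * ∑' m : ℕ, (1 / M ^ 2) /
      (1 + 1 / M ^ 2) * (1 / (1 + 1 / M ^ 2)) ^ m * (m : ℝ) ^ 2
  set ρ₀ := 1 / M - 1 / M ^ 2 with hρ₀
  have hρ₀0 : 0 < ρ₀ := by
    rw [hρ₀, sub_pos]
    exact one_div_lt_one_div_of_lt hM0 (by nlinarith)
  have hlog : Tendsto (fun d : ℕ => Real.log d) atTop atTop :=
    Real.tendsto_log_atTop.comp tendsto_natCast_atTop_atTop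
  obtain ⟨D, hD⟩ := eventually_atTop.1 ((hlog.eventually_gt_atTop (2 * C / ε)).and
    ((hlog.eventually_ge_atTop 1).and ((tendsto_natCast_atTop_atTop (R := ℝ)).eventually_gt_atTop
      (2 * (-Real.log ρ₀ + 2) / ρ₀))))
  refine ⟨D, fun d hd Λ _ _ _ w hw hw1 R F hF hind => ?_⟩
  obtain ⟨hd1, hd2, hd3⟩ := hD d hd.le
  have hd0 : (0 : ℝ) < d := by
    rcases Nat.eq_zero_or_pos d with rfl | h
    · simp at hd2; linarith
    · exact_mod_cast h
  by_contra! hlt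
  set ρ := localDensity w R F
  have hlb : 0 < (1 + ε) * (Real.log d / d) := by positivity
  have hρ : 0 < ρ := hlb.trans hlt
  have hsmall : ρ ≤ ρ₀ := by
    by_contra! hgt
    have h1 := degree_mul_localDensity_le_crude hw hw1 hF hind hρ
    have h2 := Real.log_le_log hρ₀0 hgt.le
    rw [div_lt_iff₀ hρ₀0] at hd3
    have h3 : (d : ℝ) * ρ₀ ≤ d * ρ := by gcongr
    linarith
  have h1 := degree_mul_localDensity_le hw hw1 hF hind hρ hM hsmall
  change d * ρ * (1 - 1 / M) ≤ -Real.log ρ + C at h1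
  have h2 : (1 + ε) * Real.log d ≤ d * ρ := by
    have := mul_le_mul_of_nonneg_left hlt.le hd0.le
    calc _ = d * ((1 + ε) * (Real.log d / d)) := by field_simp
      _ ≤ _ := this
  have h3 : 0 ≤ 1 - 1 / M := by
    rw [sub_nonneg, div_le_one hM0]; exact hM.le
  have h4 := mul_le_mul_of_nonneg_right h2 h3
  have h5 : (1 + ε) * Real.log d * (1 - 1 / M) = (1 + ε / 2) * Real.log d := by
    rw [hMd]; field_simp; ring
  -- Since `log d ≥ 1`, the assumed lower bound on `ρ` exceeds `1 / d`.
  have h6 : -Real.log d ≤ Real.log ρ := by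
    rw [← Real.log_inv]
    refine Real.log_le_log (by positivity) (le_trans ?_ hlt.le)
    rw [← mul_div_assoc, inv_eq_one_div]
    gcongr
    nlinarith
  rw [div_lt_iff₀ hε] at hd1
  linarith

end LocalRules

/-! ### Approximation of measurable factors by local rules. -/

section Approximation

instance (d : ℕ) : IsProbabilityMeasure (labelMeasure d) := by
  unfold labelMeasure; infer_instance

/-- A set of labellings is finitary if it is given by a local rule for finitely valued measurable
functions of the labels. -/
def IsFinitary {d : ℕ} (S : Set (TreeLabelling d)) : Prop :=
  ∃ (Λ : Type) (_ : Fintype Λ) (q : unitInterval → Λ) (R : ℕ) (F : (TreeVertex d → Λ) → Bool),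
    (∀ t, MeasurableSet (q ⁻¹' {t})) ∧ IsLocal R F ∧ S = {x | F (fun v => q (x v)) = true}

theorem IsLocal.mono {Λ β : Type*} {d R R' : ℕ} {F : (TreeVertex d → Λ) → β} (hF : IsLocal R F)
    (h : R ≤ R') : IsLocal R' F :=
  fun x y hxy => hF x y fun v hv => hxy v (hv.trans h)

theorem IsFinitary.combine {d : ℕ} {S T : Set (TreeLabelling d)} (hS : IsFinitary S)
    (hT : IsFinitary T) (op : Bool → Bool → Bool) {U : Set (TreeLabelling d)}
    (hU : ∀ (a b : Bool) (x : TreeLabelling d), (x ∈ S ↔ a = true) → (x ∈ T ↔ b = true) →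
      (x ∈ U ↔ op a b = true)) :
    IsFinitary U := by
  obtain ⟨Λ, _, q, R, F, hq, hF, rfl⟩ := hS
  obtain ⟨Λ', _, q', R', F', hq', hF', rfl⟩ := hT
  refine ⟨Λ × Λ', inferInstance, fun t => (q t, q' t), max R R',
    fun z => op (F fun v => (z v).1) (F' fun v => (z v).2), fun t => ?_, fun x y hxy => ?_, ?_⟩
  · have : (fun s => (q s, q' s)) ⁻¹' {t} = q ⁻¹' {t.1} ∩ q' ⁻¹' {t.2} := by
      ext s; simp [Prod.ext_iff]
    rw [this]
    exact (hq _).inter (hq' _)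
  · have h1 := hF (fun v => (x v).1) (fun v => (y v).1) fun v hv => by
      rw [hxy v (hv.trans (le_max_left _ _))]
    have h2 := hF' (fun v => (x v).2) (fun v => (y v).2) fun v hv => by
      rw [hxy v (hv.trans (le_max_right _ _))]
    simp only [h1, h2]
  · ext x
    exact hU _ _ x Iff.rfl Iff.rfl

theorem isSetRing_isFinitary (d : ℕ) : IsSetRing {S : Set (TreeLabelling d) | IsFinitary S} where
  empty_mem := ⟨Unit, inferInstance, fun _ => (), 0, fun _ => false,
    fun _ => measurable_const (measurableSet_singleton _), fun _ _ _ => rfl, by simp⟩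
  union_mem := fun S T hS hT => IsFinitary.combine hS hT (· || ·) fun a b x ha hb => by
    simp [Set.mem_union, ha, hb]
  sdiff_mem := fun S T hS hT => IsFinitary.combine hS hT (fun a b => a && !b) fun a b x ha hb => by
    simp [Set.mem_sdiff, ha, hb]

/-- The set of labels with prescribed values of `q` on a ball. -/
def ballBox {d R : ℕ} {Λ : Type*} [Inhabited Λ] (q : unitInterval → Λ) (z : WordBall d R → Λ) :
    Set (TreeLabelling d) :=
  Set.pi ((finite_wordBall d R).toFinset : Set (TreeVertex d))
    fun v => q ⁻¹' {extendBall z v}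

theorem mem_ballBox {d R : ℕ} {Λ : Type*} [Inhabited Λ] {q : unitInterval → Λ}
    {z : WordBall d R → Λ} {x : TreeLabelling d} :
    x ∈ ballBox q z ↔ (fun v : WordBall d R => q (x v.1)) = z := by
  constructor
  · intro h
    funext v
    have := h v.1 (by simp)
    simpa [extendBall, v.2] using this
  · rintro rfl v hv
    have hv' : v.1.length ≤ R := by simpa using hv
    simp [extendBall, hv']

theorem measurableSet_ballBox {d R : ℕ} {Λ : Type*} [Inhabited Λ] {q : unitInterval → Λ}
    (hq : ∀ t, MeasurableSet (q ⁻¹' {t})) (z : WordBall d R → Λ) : MeasurableSet (ballBox q z) :=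
  MeasurableSet.pi (Finset.countable_toSet _) fun _ _ => hq _

theorem measureReal_ballBox {d R : ℕ} {Λ : Type*} [Inhabited Λ] {q : unitInterval → Λ}
    (hq : ∀ t, MeasurableSet (q ⁻¹' {t})) (z : WordBall d R → Λ) :
    (labelMeasure d).real (ballBox q z) =
      ∏ v, (volume : Measure unitInterval).real (q ⁻¹' {z v}) := by
  rw [measureReal_def, labelMeasure, ballBox, Measure.infinitePi_pi _ fun v _ => hq _,
    ENNReal.toReal_prod]
  refine (Finset.prod_subtype (p := fun v : TreeVertex d => v.1.length ≤ R)
    (F := inferInstanceAs (Fintype (WordBall d R))) _ (fun v => by simp) _).trans ?_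
  refine Finset.prod_congr rfl fun v _ => ?_
  simp [extendBall, v.2, measureReal_def]

theorem setOf_local_eq_iUnion {d R : ℕ} {Λ : Type*} [Fintype Λ] [Inhabited Λ]
    (q : unitInterval → Λ) {F : (TreeVertex d → Λ) → Bool} (hF : IsLocal R F) :
    {x : TreeLabelling d | F (fun v => q (x v)) = true} =
      ⋃ z ∈ Finset.univ.filter (fun z : WordBall d R → Λ => F (extendBall z) = true),
        ballBox q z := by
  have key : ∀ x : TreeLabelling d, F (fun v => q (x v)) =
      F (extendBall fun v : WordBall d R => q (x v.1)) := fun x =>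
    hF _ _ fun v hv => by simp [extendBall, hv]
  ext x
  simp only [Set.mem_ofPred_eq, Set.mem_iUnion, mem_ballBox, Finset.mem_filter, Finset.mem_univ,
    true_and, exists_prop, exists_eq_right', key]

theorem measurableSet_setOf_local {d R : ℕ} {Λ : Type*} [Fintype Λ] [Inhabited Λ]
    {q : unitInterval → Λ} (hq : ∀ t, MeasurableSet (q ⁻¹' {t}))
    {F : (TreeVertex d → Λ) → Bool} (hF : IsLocal R F) :
    MeasurableSet {x : TreeLabelling d | F (fun v => q (x v)) = true} := by
  rw [setOf_local_eq_iUnion q hF]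
  exact Finset.measurableSet_biUnion _ fun z _ => measurableSet_ballBox hq z

theorem measureReal_setOf_local {d R : ℕ} {Λ : Type*} [Fintype Λ] [Inhabited Λ]
    {q : unitInterval → Λ} (hq : ∀ t, MeasurableSet (q ⁻¹' {t}))
    {F : (TreeVertex d → Λ) → Bool} (hF : IsLocal R F) :
    (labelMeasure d).real {x : TreeLabelling d | F (fun v => q (x v)) = true} =
      localDensity (fun t => (volume : Measure unitInterval).real (q ⁻¹' {t})) R F := by
  rw [setOf_local_eq_iUnion q hF, measureReal_biUnion_finset]
  · rw [localDensity, prodExpect, Finset.sum_filter]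
    refine Finset.sum_congr rfl fun z _ => ?_
    rw [measureReal_ballBox hq]
    split_ifs <;> simp
  · intro z _ z' _ hzz'
    rw [Function.onFun, Set.disjoint_left]
    intro x hx hx'
    rw [mem_ballBox] at hx hx'
    exact hzz' (hx.symm.trans hx')
  · exact fun z _ => measurableSet_ballBox hq z

theorem IsFinitary.measurableSet {d : ℕ} {S : Set (TreeLabelling d)} (hS : IsFinitary S) :
    MeasurableSet S := by
  obtain ⟨Λ, _, q, R, F, hq, hF, rfl⟩ := hS
  have : Inhabited Λ := ⟨q 0⟩
  exact measurableSet_setOf_local hq hF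

theorem generateFrom_isFinitary (d : ℕ) :
    (inferInstance : MeasurableSpace (TreeLabelling d)) =
      MeasurableSpace.generateFrom {S : Set (TreeLabelling d) | IsFinitary S} := by
  classical
  refine le_antisymm (iSup_le fun v => ?_)
    (MeasurableSpace.generateFrom_le fun S hS => IsFinitary.measurableSet hS)
  rintro _ ⟨A, hA, rfl⟩
  refine MeasurableSpace.measurableSet_generateFrom ⟨Bool, inferInstance, fun t => decide (t ∈ A),
    v.1.length, fun z => z v, fun t => ?_, fun x y hxy => hxy v le_rfl, ?_⟩
  · cases t
    · convert hA.compl using 1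
      ext s; simp
    · convert hA using 1
      ext s; simp
  · ext x; simp

theorem measurePreserving_relabel {d : ℕ} (φ : regularTree d ≃g regularTree d) :
    MeasurePreserving (relabel φ) (labelMeasure d) (labelMeasure d) := by
  refine ⟨measurable_pi_lambda _ fun v => measurable_pi_apply _, ?_⟩
  exact Measure.map_infinitePi_infinitePi_of_inj
    (P := fun _ : TreeVertex d => (volume : Measure unitInterval)) φ.symm.injective

theorem endMulIso_singleton {d : ℕ} (j : Fin d) :
    endMulIso j ⟨[j], List.isChain_singleton j⟩ = treeRoot d :=
  Subtype.ext (by simp [endMulIso, endMul, treeRoot])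

theorem treeRoot_mem_factorProcess_iff {d : ℕ} {f : TreeLabelling d → Bool} (hf : IsFactor f)
    (x : TreeLabelling d) : treeRoot d ∈ factorProcess f x ↔ f x = true :=
  mem_factorProcess_iff hf x (v := treeRoot d) (RelIso.refl _) rfl

/-- A factor of i.i.d. independent set is approximated by local rules for finitely valued labels
that produce independent sets for all labellings. -/
theorem exists_localDensity_gt {d : ℕ} {f : TreeLabelling d → Bool} (hf : IsIndepSetFactor f)
    {c : ℝ} (hc : c < factorDensity f) :
    ∃ (Λ : Type) (_ : Fintype Λ) (_ : Inhabited Λ) (w : Λ → ℝ) (R : ℕ)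
      (F : (TreeVertex d → Λ) → Bool), (∀ t, 0 ≤ w t) ∧ ∑ t, w t = 1 ∧ IsLocal R F ∧
      (∀ x j, ¬ (F x = true ∧ F (fun v => x (endMulIso j v)) = true)) ∧
      c < localDensity w R F := by
  classical
  set μ := labelMeasure d with hμ
  set A : Set (TreeLabelling d) := {x | f x = true} with hA
  have hAm : MeasurableSet A := hf.isFactor.measurable (measurableSet_singleton true)
  have hdens : factorDensity f = μ.real A := by
    simp only [factorDensity, treeRoot_mem_factorProcess_iff hf.isFactor, hA, hμ]
  -- One error for the root and one for each of its `d` neighbours must fit into `factorDensity f -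
  -- c`.
  set η : ℝ := (factorDensity f - c) / (d + 1) with hη
  have hη0 : 0 < η := div_pos (by linarith) (by positivity)
  obtain ⟨S, hS, hSA⟩ := exists_measure_symmDiff_lt_of_generateFrom_isSetRing (μ := μ)
    (isSetRing_isFinitary d) ⟨{Set.univ}, Set.countable_singleton _, by
      rintro _ rfl
      exact ⟨Unit, inferInstance, fun _ => (), 0, fun _ => true,
        fun _ => measurable_const (measurableSet_singleton _), fun _ _ _ => rfl, by simp⟩,
      by simp⟩ (generateFrom_isFinitary d) hAm (ENNReal.ofReal_pos.2 hη0)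
  have hSm := IsFinitary.measurableSet hS
  obtain ⟨Λ, _, q, R, F₀, hq, hF₀, rfl⟩ := hS
  have : Inhabited Λ := ⟨q 0⟩
  set S : Set (TreeLabelling d) := {x | F₀ (fun v => q (x v)) = true} with hSd
  have hSA' : μ.real (symmDiff S A) < η := by
    rw [measureReal_def]
    exact ENNReal.toReal_lt_of_lt_ofReal hSA
  -- Dropping a vertex that has a chosen neighbour makes the set independent for every labelling, at
  -- the price of one more unit of range.
  let F : (TreeVertex d → Λ) → Bool := fun x =>
    decide (F₀ x = true ∧ ∀ j, F₀ (fun v => x (endMulIso j v)) = false)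
  have hF : IsLocal (R + 1) F := by
    intro x y hxy
    have h1 : F₀ x = F₀ y := hF₀ _ _ fun v hv => hxy v (by omega)
    have h2 : ∀ j, F₀ (fun v => x (endMulIso j v)) = F₀ (fun v => y (endMulIso j v)) :=
      fun j => hF₀ _ _ fun v hv => hxy _ ((endMul_length_le j v.1).trans (by omega))
    simp only [F, h1, h2]
  refine ⟨Λ, inferInstance, inferInstance,
    fun t => (volume : Measure unitInterval).real (q ⁻¹' {t}), R + 1, F,
    fun t => measureReal_nonneg, ?_, hF, ?_, ?_⟩
  · rw [← measureReal_biUnion_finset]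
    · have : (⋃ t ∈ (Finset.univ : Finset Λ), q ⁻¹' {t}) = Set.univ := by ext; simp
      rw [this]
      exact probReal_univ
    · intro t _ t' _ htt'
      rw [Function.onFun, Set.disjoint_left]
      intro s hs hs'
      exact htt' (hs.symm.trans hs')
    · exact fun t _ => hq t
  · rintro x j ⟨h1, h2⟩
    simp only [F, decide_eq_true_eq] at h1 h2
    rw [h1.2 j] at h2
    exact absurd h2.1 (by simp)
  · rw [← measureReal_setOf_local hq hF]
    set T : Set (TreeLabelling d) := {x | F (fun v => q (x v)) = true}
    -- If the approximation is correct at the root and at all its neighbours, almost sure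
    -- independence of the factor shows that a chosen root is not dropped.
    have hsub : A ≤ᵐ[μ] (T ∪ symmDiff S A ∪
        ⋃ j ∈ (Finset.univ : Finset (Fin d)), relabel (endMulIso j) ⁻¹' symmDiff S A :
        Set (TreeLabelling d)) := by
      filter_upwards [hf.indep] with x hx hxA
      by_cases h1 : x ∈ symmDiff S A
      · exact Or.inl (Or.inr h1)
      by_cases h2 : ∃ j, relabel (endMulIso j) x ∈ symmDiff S A
      · obtain ⟨j, hj⟩ := h2
        exact Or.inr (Set.mem_iUnion₂.2 ⟨j, Finset.mem_univ j, hj⟩)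
      refine Or.inl (Or.inl ?_)
      have hxS : x ∈ S := by
        by_contra h
        exact h1 (Or.inr ⟨hxA, h⟩)
      change decide _ = true
      rw [decide_eq_true_eq]
      refine ⟨hxS, fun j => ?_⟩
      by_contra hj
      have hjS : relabel (endMulIso j) x ∈ S := Bool.eq_true_of_not_eq_false hj
      have hjA : relabel (endMulIso j) x ∈ A := by
        by_contra h
        exact h2 ⟨j, Or.inl ⟨hjS, h⟩⟩
      have m1 : treeRoot d ∈ factorProcess f x :=
        (treeRoot_mem_factorProcess_iff hf.isFactor x).2 hxA
      have m2 : (⟨[j], List.isChain_singleton j⟩ : TreeVertex d) ∈ factorProcess f x :=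
        ⟨endMulIso j, endMulIso_singleton j, hjA⟩
      refine hx m1 m2 (fun h => ?_) (Or.inl ⟨j, rfl⟩)
      simpa [treeRoot] using congrArg (fun v => v.1.length) h
    have hle : μ.real A ≤ μ.real T + μ.real (symmDiff S A) + ∑ j : Fin d, μ.real (symmDiff S A) := by
      calc μ.real A ≤ _ := ENNReal.toReal_mono (measure_ne_top _ _) (measure_mono_ae hsub)
        _ ≤ μ.real (T ∪ symmDiff S A) +
            μ.real (⋃ j ∈ (Finset.univ : Finset (Fin d)),
              relabel (endMulIso j) ⁻¹' symmDiff S A) := measureReal_union_le _ _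
        _ ≤ _ := by
            gcongr
            · exact measureReal_union_le _ _
            · refine (measureReal_biUnion_finset_le _ _).trans (Finset.sum_le_sum fun j _ => ?_)
              exact ((measurePreserving_relabel (endMulIso j)).measureReal_preimage
                (hSm.symmDiff hAm).nullMeasurableSet).le
    rw [Finset.sum_const, Finset.card_univ, Fintype.card_fin, nsmul_eq_mul] at hle
    have : η * (d + 1) = factorDensity f - c := div_mul_cancel₀ _ (by positivity)
    have h3 : (d + 1 : ℝ) * μ.real (symmDiff S A) < (d + 1) * η := by gcongr
    linarith

/-- The upper bound for the density of factor of i.i.d. independent sets. -/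
theorem exists_factorDensity_bound {ε : ℝ} (hε : 0 < ε) : ∃ D : ℕ, ∀ d : ℕ, D < d →
    ∀ f : TreeLabelling d → Bool, IsIndepSetFactor f →
      factorDensity f ≤ (1 + ε) * (Real.log d / d) := by
  classical
  obtain ⟨D, hD⟩ := exists_localDensity_bound hε
  refine ⟨D, fun d hd f hf => ?_⟩
  by_contra! h
  obtain ⟨Λ, _, _, w, R, F, hw, hw1, hF, hind, hlt⟩ := exists_localDensity_gt hf h
  exact absurd (hD d hd Λ w hw hw1 R F hF hind) (not_le.2 hlt)

end Approximation

/-! ### Greedy independent sets as factors. -/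

section Greedy

variable {d : ℕ}

/-- The approximations to the greedy independent set that lets the vertices join in the order of
their labels. -/
def greedySet : ℕ → TreeLabelling d → Set (TreeVertex d)
  | 0, _ => ∅
  | n + 1, x => {v | ∀ u, (regularTree d).Adj v u → x u ≤ x v → u ∉ greedySet n x}

theorem mem_greedySet_succ {n : ℕ} {x : TreeLabelling d} {v : TreeVertex d} :
    v ∈ greedySet (n + 1) x ↔
      ∀ u, (regularTree d).Adj v u → x u ≤ x v → u ∉ greedySet n x := Iff.rfl

theorem map_mem_greedySet_relabel (φ : regularTree d ≃g regularTree d) (n : ℕ)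
    (x : TreeLabelling d) (v : TreeVertex d) :
    φ v ∈ greedySet n (relabel φ x) ↔ v ∈ greedySet n x := by
  induction n generalizing v with
  | zero => simp [greedySet]
  | succ n ih =>
    rw [mem_greedySet_succ, mem_greedySet_succ]
    have hr : ∀ u, relabel φ x (φ u) = x u := fun u => by simp [relabel]
    constructor
    · intro h u hu hx
      rw [← ih u]
      exact h (φ u) (φ.map_adj_iff.2 hu) (by rwa [hr, hr])
    · intro h u hu hx
      obtain ⟨u, rfl⟩ := φ.surjective u
      rw [hr, hr] at hx
      rw [ih u]
      exact h u (φ.map_adj_iff.1 hu) hx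

/-- Each stage excludes vertices by means of the previous one, so the step reverses inclusions.
Starting from the empty set, even stages lie inside the adjacent odd ones. -/
theorem greedySet_subset (x : TreeLabelling d) (m : ℕ) :
    greedySet (2 * m) x ⊆ greedySet (2 * m + 1) x ∧
      greedySet (2 * (m + 1)) x ⊆ greedySet (2 * m + 1) x := by
  induction m with
  | zero =>
    exact ⟨fun v hv => hv.elim, fun v _ u _ _ hu => hu.elim⟩
  | succ m ih =>
    have h1 : greedySet (2 * (m + 1)) x ⊆ greedySet (2 * (m + 1) + 1) x :=
      fun v hv u huv hx hu => hv u huv hx (ih.2 hu)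
    exact ⟨h1, fun v hv u huv hx hu => hv u huv hx (h1 hu)⟩

/-- Of two adjacent members, one with the smaller label also lies in the preceding odd stage and
there blocks the other. Ties do no harm. -/
theorem isIndepSet_greedySet (x : TreeLabelling d) (m : ℕ) :
    (regularTree d).IsIndepSet (greedySet (2 * m) x) := by
  cases m with
  | zero => exact fun v hv => hv.elim
  | succ m =>
    intro u hu v hv _ huv
    rcases le_total (x u) (x v) with h | h
    · exact hv u huv.symm h ((greedySet_subset x m).2 hu)
    · exact hu v huv h ((greedySet_subset x m).2 hv)

instance : Countable (TreeVertex d) := Subtype.countable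

theorem measurableSet_mem_greedySet (n : ℕ) (v : TreeVertex d) :
    MeasurableSet {x : TreeLabelling d | v ∈ greedySet n x} := by
  induction n generalizing v with
  | zero => simp [greedySet]
  | succ n ih =>
    have : {x : TreeLabelling d | v ∈ greedySet (n + 1) x} =
        ⋂ u, ⋂ (_ : (regularTree d).Adj v u),
          ({x | x u ≤ x v} ∩ {x | u ∈ greedySet n x})ᶜ := by
      ext x
      simp [mem_greedySet_succ]
    rw [this]
    exact MeasurableSet.iInter fun u => MeasurableSet.iInter fun _ =>
      ((measurableSet_le (measurable_pi_apply u) (measurable_pi_apply v)).inter (ih u)).compl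

open Classical in
/-- The factor that generates the greedy independent sets. -/
noncomputable def greedyFactor (m : ℕ) (x : TreeLabelling d) : Bool :=
  decide (treeRoot d ∈ greedySet (2 * m) x)

theorem greedyFactor_eq_true {m : ℕ} {x : TreeLabelling d} :
    greedyFactor m x = true ↔ treeRoot d ∈ greedySet (2 * m) x := by
  simp [greedyFactor]

theorem isFactor_greedyFactor (m : ℕ) : IsFactor (greedyFactor (d := d) m) where
  measurable := by
    refine measurable_to_bool ?_
    have : greedyFactor (d := d) m ⁻¹' {true} = {x | treeRoot d ∈ greedySet (2 * m) x} := by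
      ext x; simp [greedyFactor_eq_true]
    rw [this]
    exact measurableSet_mem_greedySet _ _
  invariant := by
    intro φ hφ x
    rw [Bool.eq_iff_iff, greedyFactor_eq_true, greedyFactor_eq_true,
      ← map_mem_greedySet_relabel φ (2 * m) x, hφ]

theorem factorProcess_greedyFactor (m : ℕ) (x : TreeLabelling d) :
    factorProcess (greedyFactor m) x = greedySet (2 * m) x := by
  ext v
  obtain ⟨φ, hφ⟩ := exists_iso_root v
  rw [mem_factorProcess_iff (isFactor_greedyFactor m) x φ hφ, greedyFactor_eq_true, ← hφ,
    map_mem_greedySet_relabel]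

theorem isIndepSetFactor_greedyFactor (m : ℕ) : IsIndepSetFactor (greedyFactor (d := d) m) where
  isFactor := isFactor_greedyFactor m
  indep := ae_of_all _ fun x => by
    rw [factorProcess_greedyFactor]
    exact isIndepSet_greedySet x m

/-- The version of the greedy approximation in which a vertex looks at its children only. -/
def rootedGreedySet : ℕ → TreeLabelling d → Set (TreeVertex d)
  | 0, _ => ∅
  | n + 1, x => {v | ∀ u : TreeVertex d, (∃ a, u.1 = a :: v.1) → x u ≤ x v →
      u ∉ rootedGreedySet n x}

theorem mem_rootedGreedySet_succ {n : ℕ} {x : TreeLabelling d} {v : TreeVertex d} :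
    v ∈ rootedGreedySet (n + 1) x ↔
      ∀ u : TreeVertex d, (∃ a, u.1 = a :: v.1) → x u ≤ x v → u ∉ rootedGreedySet n x := Iff.rfl

/-- A parent with a larger label cannot block. Only children with smaller labels matter, and these
again have a parent with a larger label. At the root the condition is vacuous. -/
theorem mem_greedySet_iff_rooted {x : TreeLabelling d} (hx : Function.Injective x) (n : ℕ)
    (v : TreeVertex d) (hv : ∀ u : TreeVertex d, (∃ a, v.1 = a :: u.1) → x v < x u) :
    v ∈ greedySet n x ↔ v ∈ rootedGreedySet n x := by
  induction n generalizing v with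
  | zero => rfl
  | succ n ih =>
    rw [mem_greedySet_succ, mem_rootedGreedySet_succ]
    have child : ∀ u : TreeVertex d, (∃ a, u.1 = a :: v.1) → x u ≤ x v →
        (u ∈ greedySet n x ↔ u ∈ rootedGreedySet n x) := by
      rintro u ⟨a, ha⟩ hle
      refine ih u ?_
      rintro u' ⟨b, hb⟩
      rw [ha] at hb
      have : u' = v := Subtype.ext (List.cons.inj hb).2.symm
      rw [this]
      refine lt_of_le_of_ne hle fun h => ?_
      have := congrArg (fun v => v.1.length) (hx h)
      simp [ha] at this
    constructor
    · intro h u hu hle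
      rw [← child u hu hle]
      exact h u (Or.inl hu) hle
    · rintro h u (hu | hu) hle
      · rw [child u hu hle]
        exact h u hu hle
      · exact absurd (hv u hu) (not_lt.2 hle)

theorem ae_injective_labels : ∀ᵐ x ∂(labelMeasure d), Function.Injective x := by
  have h : ∀ u v : TreeVertex d, u ≠ v → ∀ᵐ x ∂(labelMeasure d), x u ≠ x v := by
    intro u v huv
    have hmap : (labelMeasure d).map (fun x => (x u, x v)) = volume.prod volume :=
      Measure.infinitePi_map_eval_prod (P := fun _ : TreeVertex d =>
        (volume : Measure unitInterval)) huv
    have hm : Measurable fun x : TreeLabelling d => (x u, x v) := by fun_prop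
    have hdiag : (volume.prod volume : Measure (unitInterval × unitInterval))
        {p | p.1 = p.2} = 0 := by
      rw [Measure.prod_apply (measurableSet_eq_fun measurable_fst measurable_snd)]
      simp [Set.preimage]
    rw [ae_iff]
    have := Measure.map_apply hm (μ := labelMeasure d)
      (measurableSet_eq_fun (measurable_fst (α := unitInterval) (β := unitInterval)) measurable_snd)
    rw [hmap, hdiag] at this
    simpa using this.symm
  have h' : ∀ᵐ x ∂(labelMeasure d), ∀ u v : TreeVertex d, u ≠ v → x u ≠ x v := by
    rw [ae_all_iff]; intro u
    rw [ae_all_iff]; intro v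
    by_cases huv : u = v
    · exact ae_of_all _ fun x h => (h huv).elim
    · filter_upwards [h u v huv] with x hx _ using hx
  filter_upwards [h'] with x hx u v huv
  by_contra hne
  exact hx u v hne huv

theorem factorDensity_greedyFactor (m : ℕ) : factorDensity (greedyFactor (d := d) m) =
    (labelMeasure d).real {x | treeRoot d ∈ rootedGreedySet (2 * m) x} := by
  rw [factorDensity]
  refine measureReal_congr ?_
  filter_upwards [ae_injective_labels (d := d)] with x hx
  refine propext ?_
  change treeRoot d ∈ factorProcess (greedyFactor m) x ↔ treeRoot d ∈ rootedGreedySet (2 * m) x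
  rw [factorProcess_greedyFactor]
  refine mem_greedySet_iff_rooted hx _ _ ?_
  rintro u ⟨a, ha⟩
  simp [treeRoot] at ha

end Greedy

/-! ### Independence of functions of disjoint sets of coordinates. -/

section DisjointCoordinates

/-- Disjointness embeds the sigma type of the blocks into `V`; currying the product measure over it
gives a product of block measures. -/
theorem iIndepFun_restrict_of_pairwise_disjoint {ι V Ω : Type*} [MeasurableSpace Ω]
    (P : V → Measure Ω) [∀ v, IsProbabilityMeasure (P v)] {S : ι → Set V}
    (hS : Pairwise (Function.onFun Disjoint S)) :
    ProbabilityTheory.iIndepFun (fun i (x : V → Ω) (u : S i) => x u) (Measure.infinitePi P) := by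
  have he : Function.Injective fun p : (i : ι) × S i => p.2.1 := by
    rintro ⟨i, u, hu⟩ ⟨j, v, hv⟩ h
    change u = v at h
    subst h
    have : i = j := by
      by_contra hij
      exact Set.disjoint_left.1 (hS hij) hu hv
    subst this
    rfl
  rw [ProbabilityTheory.iIndepFun_iff_map_fun_eq_infinitePi_map (by fun_prop)]
  have h1 := Measure.map_infinitePi_infinitePi_of_inj (P := P) he
  have h2 := Measure.infinitePi_map_piCurry (κ := fun i => S i) (X := fun _ _ => Ω)
    fun (i : ι) (u : S i) => P u
  change (Measure.infinitePi fun p : (i : ι) × S i => P p.2.1).map _ = _ at h2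
  rw [← h1, Measure.map_map (by fun_prop) (by fun_prop)] at h2
  refine h2.trans ?_
  congr 1
  funext i
  exact (Measure.map_infinitePi_infinitePi_of_inj (P := P)
    (Subtype.val_injective (p := fun v => v ∈ S i))).symm

theorem iIndepFun_of_dependsOn {ι V Ω β : Type*} [MeasurableSpace Ω] [Nonempty Ω]
    [MeasurableSpace β] (P : V → Measure Ω) [∀ v, IsProbabilityMeasure (P v)] {S : ι → Set V}
    (hS : Pairwise (Function.onFun Disjoint S)) {X : ι → (V → Ω) → β}
    (hX : ∀ i, Measurable (X i)) (hXS : ∀ i, DependsOn (X i) (S i)) :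
    ProbabilityTheory.iIndepFun X (Measure.infinitePi P) := by
  classical
  let o : Ω := Classical.arbitrary Ω
  let ext : ∀ i, (S i → Ω) → V → Ω := fun i y v => if h : v ∈ S i then y ⟨v, h⟩ else o
  have hext : ∀ i, Measurable (ext i) := by
    intro i
    refine measurable_pi_lambda _ fun v => ?_
    by_cases h : v ∈ S i
    · simp only [ext, h, dif_pos]; exact measurable_pi_apply _
    · simp only [ext, h, dif_neg, not_false_eq_true]; exact measurable_const
  have h := (iIndepFun_restrict_of_pairwise_disjoint P hS).comp (fun i y => X i (ext i y))
    fun i => (hX i).comp (hext i)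
  convert h using 1
  funext i x
  exact hXS i fun v hv => by simp [ext, hv]

theorem indepFun_of_dependsOn {V Ω β γ : Type*} [MeasurableSpace Ω] [Nonempty Ω]
    [MeasurableSpace β] [MeasurableSpace γ] (P : V → Measure Ω) [∀ v, IsProbabilityMeasure (P v)]
    {S T : Set V} (hST : Disjoint S T) {X : (V → Ω) → β} {Y : (V → Ω) → γ}
    (hX : Measurable X) (hY : Measurable Y) (hXS : DependsOn X S) (hYT : DependsOn Y T) :
    ProbabilityTheory.IndepFun X Y (Measure.infinitePi P) := by
  classical
  rw [ProbabilityTheory.indepFun_iff_measure_inter_preimage_eq_mul]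
  intro A B hA hB
  have hdis : Pairwise (Function.onFun Disjoint fun b : Bool => if b then S else T) := by
    intro a b hab
    cases a <;> cases b <;> simp_all [Function.onFun, disjoint_comm]
  -- Replacing `X` and `Y` by events gives both the codomain `Prop`, so the version for families
  -- applies.
  have h := iIndepFun_of_dependsOn (β := Prop) P hdis
    (X := fun b => if b then fun x => X x ∈ A else fun x => Y x ∈ B)
    (fun b => by
      cases b
      · exact measurableSet_setOfPred.1 (hY hB)
      · exact measurableSet_setOfPred.1 (hX hA))
    (fun b x y hxy => by
      cases b
      · simp only [Bool.false_eq_true, if_false] at hxy ⊢; rw [hYT hxy]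
      · simp only [if_true] at hxy ⊢; rw [hXS hxy])
  have h2 := (h.indepFun (show true ≠ false by simp)).measure_inter_preimage_eq_mul {True} {True}
    MeasurableSet.of_discrete MeasurableSet.of_discrete
  simpa [Set.preimage, Set.inter_def] using h2

end DisjointCoordinates

/-! ### The recursion for the law of the join times. -/

section Law

variable {d : ℕ}

theorem map_label (v : TreeVertex d) :
    (labelMeasure d).map (fun x => (x v : ℝ)) = volume.restrict (Set.Icc 0 1) := by
  have h1 : (labelMeasure d).map (fun x => x v) = volume :=
    Measure.infinitePi_map_eval (fun _ : TreeVertex d => (volume : Measure unitInterval)) v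
  have h2 : (fun x : TreeLabelling d => (x v : ℝ)) = Subtype.val ∘ fun x => x v := rfl
  rw [h2, ← Measure.map_map measurable_subtype_coe (measurable_pi_apply v), h1]
  exact map_comap_subtype_coe measurableSet_Icc volume

open Classical in
/-- The label of a vertex that joins the rooted greedy set, and the value `2` otherwise. -/
noncomputable def joinTime (n : ℕ) (v : TreeVertex d) (x : TreeLabelling d) : ℝ :=
  -- The value `2` exceeds every label, so a child that does not join blocks nobody.
  if v ∈ rootedGreedySet n x then x v else 2

theorem lt_joinTime_iff {n : ℕ} {v : TreeVertex d} {x : TreeLabelling d} {s : ℝ} (hs : s ≤ 1) :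
    s < joinTime n v x ↔ ¬ ((x v : ℝ) ≤ s ∧ v ∈ rootedGreedySet n x) := by
  unfold joinTime
  split_ifs with h
  · simp [h]
  · simp only [h, and_false, not_false_eq_true, iff_true]; linarith

theorem measurableSet_mem_rootedGreedySet (n : ℕ) (v : TreeVertex d) :
    MeasurableSet {x : TreeLabelling d | v ∈ rootedGreedySet n x} := by
  induction n generalizing v with
  | zero => simp [rootedGreedySet]
  | succ n ih =>
    have : {x : TreeLabelling d | v ∈ rootedGreedySet (n + 1) x} =
        ⋂ u : TreeVertex d, ⋂ (_ : ∃ a, u.1 = a :: v.1),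
          ({x | x u ≤ x v} ∩ {x | u ∈ rootedGreedySet n x})ᶜ := by
      ext x
      simp [mem_rootedGreedySet_succ]
    rw [this]
    exact MeasurableSet.iInter fun u => MeasurableSet.iInter fun _ =>
      ((measurableSet_le (measurable_pi_apply u) (measurable_pi_apply v)).inter (ih u)).compl

theorem measurable_joinTime (n : ℕ) (v : TreeVertex d) : Measurable (joinTime n v) :=
  Measurable.ite (measurableSet_mem_rootedGreedySet n v)
    (measurable_subtype_coe.comp (measurable_pi_apply v)) measurable_const

theorem dependsOn_mem_rootedGreedySet (n : ℕ) (v : TreeVertex d) :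
    DependsOn (fun x : TreeLabelling d => v ∈ rootedGreedySet n x) {u | v.1 <:+ u.1} := by
  induction n generalizing v with
  | zero => exact fun _ _ _ => rfl
  | succ n ih =>
    intro x y hxy
    refine propext (forall_congr' fun u => forall_congr' fun hu => ?_)
    have hsub : ∀ w : TreeVertex d, u.1 <:+ w.1 → v.1 <:+ w.1 := by
      obtain ⟨a, ha⟩ := hu
      intro w hw
      exact (List.suffix_cons a v.1).trans (ha ▸ hw)
    rw [hxy v (List.suffix_refl _), hxy u (hsub u (List.suffix_refl _))]
    refine imp_congr_right fun _ => not_congr (Iff.of_eq ?_)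
    exact ih u fun w hw => hxy w (hsub w hw)

theorem dependsOn_joinTime (n : ℕ) (v : TreeVertex d) :
    DependsOn (joinTime (d := d) n v) {u | v.1 <:+ u.1} := by
  intro x y hxy
  have h := dependsOn_mem_rootedGreedySet n v hxy
  have h' : v ∈ rootedGreedySet n x ↔ v ∈ rootedGreedySet n y := Iff.of_eq h
  by_cases hv : v ∈ rootedGreedySet n x
  · rw [joinTime, joinTime, if_pos hv, if_pos (h'.1 hv), hxy v (List.suffix_refl _)]
  · rw [joinTime, joinTime, if_neg hv, if_neg fun h => hv (h'.2 h)]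

/-- The letters that extend the word of a vertex. -/
abbrev ChildLetter (v : TreeVertex d) : Type := {a : Fin d // (a :: v.1).IsChain (· ≠ ·)}

/-- The child of a vertex given by a letter. -/
def childVertex (v : TreeVertex d) (a : ChildLetter v) : TreeVertex d := ⟨a.1 :: v.1, a.2⟩

theorem mem_rootedGreedySet_succ_iff_joinTime {n : ℕ} {x : TreeLabelling d} {v : TreeVertex d} :
    v ∈ rootedGreedySet (n + 1) x ↔ ∀ a, (x v : ℝ) < joinTime n (childVertex v a) x := by
  rw [mem_rootedGreedySet_succ]
  constructor
  · intro h a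
    rw [lt_joinTime_iff (x v).2.2]
    rintro ⟨h1, h2⟩
    exact h (childVertex v a) ⟨a.1, rfl⟩ h1 h2
  · rintro h ⟨u, hu⟩ ⟨a, rfl⟩ h1 h2
    have := h ⟨a, hu⟩
    rw [lt_joinTime_iff (x v).2.2] at this
    exact this ⟨h1, h2⟩

theorem iIndepFun_joinTime_child (n : ℕ) (v : TreeVertex d) :
    ProbabilityTheory.iIndepFun (fun a => joinTime n (childVertex v a)) (labelMeasure d) := by
  refine iIndepFun_of_dependsOn (fun _ => volume)
    (S := fun a => {u : TreeVertex d | (childVertex v a).1 <:+ u.1}) ?_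
    (fun a => measurable_joinTime n _) (fun a => dependsOn_joinTime n _)
  intro a b hab
  rw [Function.onFun, Set.disjoint_left]
  intro u hu hu'
  have := List.suffix_of_suffix_length_le hu hu' (by simp [childVertex])
  have := this.eq_of_length (by simp [childVertex])
  exact hab (Subtype.ext (List.cons.inj this).1)

theorem indepFun_label_joinTime_child (n : ℕ) (v : TreeVertex d) :
    ProbabilityTheory.IndepFun (fun x : TreeLabelling d => (x v : ℝ))
      (fun x a => joinTime n (childVertex v a) x) (labelMeasure d) := by
  refine indepFun_of_dependsOn (fun _ => volume) (S := {v}) (T := {v}ᶜ) disjoint_compl_right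
    (measurable_subtype_coe.comp (measurable_pi_apply v))
    (measurable_pi_lambda _ fun a => measurable_joinTime n _)
    (fun x y hxy => by simp only [hxy v rfl]) fun x y hxy => ?_
  funext a
  refine dependsOn_joinTime n (childVertex v a) fun u hu => hxy u ?_
  rintro rfl
  have := hu.length_le
  simp [childVertex] at this

/-- The recursion for the law of the join times. -/
theorem measureReal_rootedGreedySet_succ (n : ℕ) (v : TreeVertex d) {g : ℝ → ℝ}
    (hgc : Continuous g)
    (hg : ∀ a, ∀ s ∈ Set.Icc (0 : ℝ) 1, (labelMeasure d).real
      {x | (x (childVertex v a) : ℝ) ≤ s ∧ childVertex v a ∈ rootedGreedySet n x} = g s)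
    {t : ℝ} (ht : t ∈ Set.Icc (0 : ℝ) 1) :
    (labelMeasure d).real {x | (x v : ℝ) ≤ t ∧ v ∈ rootedGreedySet (n + 1) x} =
      ∫ s in (0 : ℝ)..t, (1 - g s) ^ Fintype.card (ChildLetter v) := by
  set μ := labelMeasure d with hμ
  set T : TreeLabelling d → ChildLetter v → ℝ := fun x a => joinTime n (childVertex v a) x with hT
  have hTm : Measurable T := measurable_pi_lambda _ fun a => measurable_joinTime n _
  have hXm : Measurable fun x : TreeLabelling d => (x v : ℝ) :=
    measurable_subtype_coe.comp (measurable_pi_apply v)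
  have hmap := (indepFun_label_joinTime_child n v).map_prod_eq_prod_map_map
    hXm.aemeasurable hTm.aemeasurable
  rw [map_label] at hmap
  let M : Set (ℝ × (ChildLetter v → ℝ)) := {p | p.1 ≤ t ∧ ∀ a, p.1 < p.2 a}
  have hM : MeasurableSet M := by
    have : M = {p | p.1 ≤ t} ∩ ⋂ a, {p | p.1 < p.2 a} := by ext; simp [M]
    rw [this]
    refine (measurableSet_le measurable_fst measurable_const).inter (MeasurableSet.iInter fun a => ?_)
    exact measurableSet_lt measurable_fst ((measurable_pi_apply a).comp measurable_snd)
  have hset : {x : TreeLabelling d | (x v : ℝ) ≤ t ∧ v ∈ rootedGreedySet (n + 1) x} =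
      (fun x => ((x v : ℝ), T x)) ⁻¹' M := by
    ext x
    simp only [Set.mem_ofPred_eq, mem_rootedGreedySet_succ_iff_joinTime, Set.mem_preimage, M, hT]
  have : IsProbabilityMeasure (μ.map T) := Measure.isProbabilityMeasure_map hTm.aemeasurable
  -- When `v` has label `s`, it joins if every child's join time exceeds `s`. These times are
  -- independent of each other and of the label of `v`.
  have hsec : ∀ s ∈ Set.Icc (0 : ℝ) 1, μ.map T {y | ∀ a, s < y a} =
      ENNReal.ofReal ((1 - g s) ^ Fintype.card (ChildLetter v)) := by
    intro s hs
    have hm : MeasurableSet {y : ChildLetter v → ℝ | ∀ a, s < y a} := by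
      have : {y : ChildLetter v → ℝ | ∀ a, s < y a} = ⋂ a, {y | s < y a} := by ext; simp
      rw [this]
      exact MeasurableSet.iInter fun a => measurableSet_lt measurable_const (measurable_pi_apply a)
    rw [Measure.map_apply hTm hm]
    have e : T ⁻¹' {y | ∀ a, s < y a} = ⋂ a ∈ Finset.univ,
        joinTime n (childVertex v a) ⁻¹' Set.Ioi s := by
      ext x; simp [hT]
    rw [e, (iIndepFun_joinTime_child n v).measure_inter_preimage_eq_mul Finset.univ
      fun _ _ => measurableSet_Ioi]
    have hone : ∀ a, μ (joinTime n (childVertex v a) ⁻¹' Set.Ioi s) = ENNReal.ofReal (1 - g s) := by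
      intro a
      have hc : joinTime n (childVertex v a) ⁻¹' Set.Ioi s =
          {x | (x (childVertex v a) : ℝ) ≤ s ∧ childVertex v a ∈ rootedGreedySet n x}ᶜ := by
        ext x
        simp only [Set.mem_preimage, Set.mem_Ioi, lt_joinTime_iff hs.2]
        rfl
      have hm : MeasurableSet
          {x | (x (childVertex v a) : ℝ) ≤ s ∧ childVertex v a ∈ rootedGreedySet n x} :=
        MeasurableSet.inter (measurableSet_le (f := fun x : TreeLabelling d =>
          ((x (childVertex v a) : unitInterval) : ℝ)) (measurable_subtype_coe.comp
            (measurable_pi_apply _)) measurable_const) (measurableSet_mem_rootedGreedySet n _)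
      rw [hc, ← ENNReal.ofReal_toReal (measure_ne_top μ _), ← measureReal_def,
        probReal_compl_eq_one_sub hm, hg a s hs]
    -- Without children nothing is known about `g`, but then the exponent is zero.
    have hnn : 0 ≤ 1 - g s ∨ IsEmpty (ChildLetter v) := by
      by_cases hE : IsEmpty (ChildLetter v)
      · exact Or.inr hE
      · obtain ⟨a⟩ := not_isEmpty_iff.1 hE
        left
        rw [← hg a s hs, sub_nonneg]
        exact measureReal_le_one
    rw [Finset.prod_congr rfl fun a _ => hone a, Finset.prod_const, Finset.card_univ]
    rcases hnn with h | h
    · rw [ENNReal.ofReal_pow h]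
    · simp
  have hcont : Continuous fun s => (1 - g s) ^ Fintype.card (ChildLetter v) := by fun_prop
  have hmeas : μ ((fun x => ((x v : ℝ), T x)) ⁻¹' M) =
      ∫⁻ s in Set.Icc 0 t, ENNReal.ofReal ((1 - g s) ^ Fintype.card (ChildLetter v)) := by
    rw [← Measure.map_apply (hXm.prodMk hTm) hM, hmap, Measure.prod_apply hM]
    have e1 : ∀ s ∈ Set.Icc (0 : ℝ) 1, μ.map T (Prod.mk s ⁻¹' M) = (Set.Icc 0 t).indicator
        (fun s => ENNReal.ofReal ((1 - g s) ^ Fintype.card (ChildLetter v))) s := by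
      intro s hs
      by_cases hst : s ≤ t
      · rw [Set.indicator_of_mem (show s ∈ Set.Icc 0 t from ⟨hs.1, hst⟩), ← hsec s hs]
        congr 1
        ext y
        simp [M, hst]
      · rw [Set.indicator_of_notMem fun h => hst h.2]
        have : Prod.mk s ⁻¹' M = ∅ := by ext y; simp [M, hst]
        rw [this, measure_empty]
    rw [setLIntegral_congr_fun measurableSet_Icc e1, lintegral_indicator measurableSet_Icc,
      Measure.restrict_restrict measurableSet_Icc, Set.inter_eq_left.2 (Set.Icc_subset_Icc_right ht.2)]
  have hnn : 0 ≤ᵐ[volume.restrict (Set.Icc 0 t)]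
      fun s => (1 - g s) ^ Fintype.card (ChildLetter v) := by
    filter_upwards [self_mem_ae_restrict measurableSet_Icc] with s hs
    by_cases hE : IsEmpty (ChildLetter v)
    · simp
    · obtain ⟨a⟩ := not_isEmpty_iff.1 hE
      have : g s ≤ 1 := by
        rw [← hg a s ⟨hs.1, hs.2.trans ht.2⟩]; exact measureReal_le_one
      exact pow_nonneg (by linarith) _
  rw [hset, measureReal_def, hmeas, intervalIntegral.integral_of_le ht.1,
    ← integral_Icc_eq_integral_Ioc, integral_eq_lintegral_of_nonneg_ae hnn
      hcont.aestronglyMeasurable]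

end Law

/-! ### Picard iteration and its explicit limit. -/

section Recursion

/-- The distribution functions of the join times in a tree with `k` children per vertex. -/
noncomputable def joinProb (k : ℕ) : ℕ → ℝ → ℝ
  | 0 => fun _ => 0
  | n + 1 => fun t => ∫ s in (0 : ℝ)..t, (1 - joinProb k n s) ^ k

theorem continuous_joinProb (k n : ℕ) : Continuous (joinProb k n) := by
  induction n with
  | zero => exact continuous_const
  | succ n ih =>
    exact intervalIntegral.continuous_primitive
      (fun a b => (by fun_prop : Continuous fun s => (1 - joinProb k n s) ^ k).intervalIntegrable a b) 0

theorem joinProb_mem (k n : ℕ) {t : ℝ} (ht : t ∈ Set.Icc (0 : ℝ) 1) :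
    joinProb k n t ∈ Set.Icc (0 : ℝ) 1 := by
  induction n generalizing t with
  | zero => exact ⟨le_rfl, zero_le_one⟩
  | succ n ih =>
    have hc := continuous_joinProb k n
    have hb : ∀ s ∈ Set.Icc 0 t, (1 - joinProb k n s) ^ k ∈ Set.Icc (0 : ℝ) 1 := by
      intro s hs
      have := ih ⟨hs.1, hs.2.trans ht.2⟩
      exact ⟨pow_nonneg (by linarith [this.2]) _, pow_le_one₀ (by linarith [this.2])
        (by linarith [this.1])⟩
    have hi : IntervalIntegrable (fun s => (1 - joinProb k n s) ^ k) volume 0 t :=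
      (by fun_prop : Continuous fun s => (1 - joinProb k n s) ^ k).intervalIntegrable _ _
    constructor
    · exact intervalIntegral.integral_nonneg ht.1 fun s hs => (hb s hs).1
    · refine (intervalIntegral.integral_mono_on ht.1 hi
        (continuous_const.intervalIntegrable (u := fun _ => (1 : ℝ)) _ _)
        fun s hs => (hb s hs).2).trans ?_
      simp [ht.2]

/-- The case `c = 1` identifies the fixed point of the recursion with `κ + 1` children; `c = 2`
evaluates the root, which has `κ + 2` children. -/
theorem integral_one_add_mul_rpow {κ c t : ℝ} (hκ : 0 < κ) (hc : 0 < c) (ht : 0 ≤ t) :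
    ∫ s in (0 : ℝ)..t, (1 + κ * s) ^ (-c / κ - 1) = (1 - (1 + κ * t) ^ (-c / κ)) / c := by
  have hpos : ∀ s ∈ Set.uIcc 0 t, 0 < 1 + κ * s := by
    intro s hs
    rw [Set.uIcc_of_le ht] at hs
    have := mul_nonneg hκ.le hs.1
    linarith
  rw [intervalIntegral.integral_eq_sub_of_hasDerivAt
    (f := fun s => -(1 + κ * s) ^ (-c / κ) / c)]
  · simp only [mul_zero, add_zero, Real.one_rpow]; ring
  · intro s hs
    have h1 : HasDerivAt (fun s => 1 + κ * s) κ s := by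
      simpa using ((hasDerivAt_id s).const_mul κ).const_add 1
    have h2 := ((h1.rpow_const (p := -c / κ) (Or.inl (hpos s hs).ne')).neg).div_const c
    have e : (1 + κ * s) ^ (-c / κ - 1) = -(κ * (-c / κ) * (1 + κ * s) ^ (-c / κ - 1)) / c := by
      field_simp
    rw [e]
    exact h2
  · refine ContinuousOn.intervalIntegrable fun s hs => ?_
    exact ((by fun_prop : Continuous fun s : ℝ => 1 + κ * s).continuousAt.rpow_const
      (Or.inl (hpos s hs).ne')).continuousWithinAt

/-- The complementary distribution function of the join time of the greedy independent set. -/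
noncomputable def survival (κ t : ℝ) : ℝ := (1 + κ * t) ^ (-1 / κ)

theorem survival_mem {κ t : ℝ} (hκ : 0 < κ) (ht : 0 ≤ t) : survival κ t ∈ Set.Icc (0 : ℝ) 1 := by
  have h1 : 1 ≤ 1 + κ * t := by have := mul_nonneg hκ.le ht; linarith
  refine ⟨Real.rpow_nonneg (by linarith) _, ?_⟩
  exact Real.rpow_le_one_of_one_le_of_nonpos h1 (div_nonpos_of_nonpos_of_nonneg (by norm_num) hκ.le)

theorem survival_pow {κ t : ℝ} (hκ : 0 < κ) (ht : 0 ≤ t) {n : ℕ} {c : ℝ} (hn : (n : ℝ) = κ + c) :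
    survival κ t ^ n = (1 + κ * t) ^ (-c / κ - 1) := by
  have h1 : 0 ≤ 1 + κ * t := by have := mul_nonneg hκ.le ht; linarith
  rw [survival, ← Real.rpow_natCast, ← Real.rpow_mul h1, hn]
  congr 1
  field_simp
  ring

theorem continuousOn_survival {κ : ℝ} (hκ : 0 < κ) : ContinuousOn (survival κ) (Set.Ici 0) := by
  intro s hs
  have : 0 < 1 + κ * s := by have := mul_nonneg hκ.le hs; linarith
  exact ((by fun_prop : Continuous fun s : ℝ => 1 + κ * s).continuousAt.rpow_const
    (Or.inl this.ne')).continuousWithinAt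

theorem abs_pow_sub_pow_le_mul {a b : ℝ} (ha : a ∈ Set.Icc (0 : ℝ) 1) (hb : b ∈ Set.Icc (0 : ℝ) 1)
    (n : ℕ) : |a ^ n - b ^ n| ≤ n * |a - b| := by
  refine (abs_pow_sub_pow_le a b n).trans ?_
  rw [mul_comm |a - b|]
  refine mul_le_of_le_one_right (by positivity) (pow_le_one₀ (by positivity) ?_)
  rw [abs_of_nonneg ha.1, abs_of_nonneg hb.1]
  exact max_le ha.2 hb.2

theorem abs_integral_pow_sub_le {κ : ℝ} (hκ : 0 < κ) (k n j : ℕ) {C : ℝ} {t : ℝ}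
    (ht : t ∈ Set.Icc (0 : ℝ) 1)
    (h : ∀ s ∈ Set.Icc 0 t, |joinProb k n s - (1 - survival κ s)| ≤ C * s ^ n) :
    |(∫ s in (0 : ℝ)..t, (1 - joinProb k n s) ^ j) - ∫ s in (0 : ℝ)..t, survival κ s ^ j| ≤
      j * C * (t ^ (n + 1) / (n + 1)) := by
  have hc := continuous_joinProb k n
  have hi1 : IntervalIntegrable (fun s => (1 - joinProb k n s) ^ j) volume 0 t :=
    (by fun_prop : Continuous fun s => (1 - joinProb k n s) ^ j).intervalIntegrable _ _
  have hi2 : IntervalIntegrable (fun s => survival κ s ^ j) volume 0 t := by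
    refine (((continuousOn_survival hκ).pow j).mono ?_).intervalIntegrable
    rw [Set.uIcc_of_le ht.1]
    exact fun s hs => hs.1
  rw [← intervalIntegral.integral_sub hi1 hi2]
  have hb : ∀ s ∈ Set.Icc 0 t, |(1 - joinProb k n s) ^ j - survival κ s ^ j| ≤ j * C * s ^ n := by
    intro s hs
    have h1 := joinProb_mem k n (t := s) ⟨hs.1, hs.2.trans ht.2⟩
    have h2 := abs_pow_sub_pow_le_mul (a := 1 - joinProb k n s)
      ⟨by linarith [h1.2], by linarith [h1.1]⟩ (survival_mem hκ hs.1) j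
    have h3 : |1 - joinProb k n s - survival κ s| = |joinProb k n s - (1 - survival κ s)| := by
      rw [← abs_neg]; congr 1; ring
    rw [h3] at h2
    refine h2.trans ?_
    rw [mul_assoc]
    exact mul_le_mul_of_nonneg_left (h s hs) (Nat.cast_nonneg _)
  refine (intervalIntegral.abs_integral_le_integral_abs ht.1).trans
    ((intervalIntegral.integral_mono_on ht.1 (hi1.sub hi2).abs ?_ hb).trans ?_)
  · exact (by fun_prop : Continuous fun s : ℝ => (j : ℝ) * C * s ^ n).intervalIntegrable _ _
  · rw [intervalIntegral.integral_const_mul, integral_pow]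
    simp

/-- `survival κ` solves `y' = -y ^ k` with `y 0 = 1`, and `joinProb k` is the Picard iteration for
`1 - y`. On `[0, 1]` the power is `k`-Lipschitz, which gives the factorial error. -/
theorem abs_joinProb_sub_le {k : ℕ} {κ : ℝ} (hκ : 0 < κ) (hk : (k : ℝ) = κ + 1) (n : ℕ) {t : ℝ}
    (ht : t ∈ Set.Icc (0 : ℝ) 1) :
    |joinProb k n t - (1 - survival κ t)| ≤ (k : ℝ) ^ n / n.factorial * t ^ n := by
  induction n generalizing t with
  | zero =>
    have := survival_mem hκ ht.1
    simp only [joinProb, pow_zero, Nat.factorial_zero, Nat.cast_one, div_one, mul_one, zero_sub,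
      abs_neg]
    rw [abs_of_nonneg (by linarith [this.2])]
    linarith [this.1]
  | succ n ih =>
    have h1 : 1 - survival κ t = ∫ s in (0 : ℝ)..t, survival κ s ^ k := by
      have h2 := integral_one_add_mul_rpow hκ one_pos ht.1
      rw [div_one] at h2
      rw [survival, ← h2]
      refine intervalIntegral.integral_congr fun s hs => ?_
      rw [Set.uIcc_of_le ht.1] at hs
      exact (survival_pow hκ hs.1 hk).symm
    rw [h1]
    refine (abs_integral_pow_sub_le hκ k n k ht fun s hs =>
      ih ⟨hs.1, hs.2.trans ht.2⟩).trans (le_of_eq ?_)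
    rw [Nat.factorial_succ]
    push_cast
    field_simp
    ring

theorem tendsto_integral_joinProb {k d : ℕ} {κ : ℝ} (hκ : 0 < κ) (hk : (k : ℝ) = κ + 1)
    (hd : (d : ℝ) = κ + 2) :
    Tendsto (fun n => ∫ s in (0 : ℝ)..1, (1 - joinProb k n s) ^ d) atTop
      (𝓝 ((1 - (1 + κ) ^ (-2 / κ)) / 2)) := by
  have h1 : ∫ s in (0 : ℝ)..1, survival κ s ^ d = (1 - (1 + κ) ^ (-2 / κ)) / 2 := by
    have h2 := integral_one_add_mul_rpow hκ two_pos zero_le_one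
    rw [mul_one] at h2
    rw [← h2]
    refine intervalIntegral.integral_congr fun s hs => ?_
    rw [Set.uIcc_of_le zero_le_one] at hs
    exact survival_pow hκ hs.1 hd
  rw [← h1, tendsto_iff_dist_tendsto_zero]
  have h3 : Tendsto (fun n : ℕ => (d : ℝ) * ((k : ℝ) ^ n / n.factorial)) atTop (𝓝 0) := by
    simpa using (FloorSemiring.tendsto_pow_div_factorial_atTop (k : ℝ)).const_mul (d : ℝ)
  refine squeeze_zero (fun _ => dist_nonneg) (fun n => ?_) h3
  rw [Real.dist_eq]
  refine (abs_integral_pow_sub_le hκ k n d (C := (k : ℝ) ^ n / n.factorial)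
    (⟨zero_le_one, le_rfl⟩ : (1 : ℝ) ∈ Set.Icc (0 : ℝ) 1)
    fun s hs => abs_joinProb_sub_le hκ hk n hs).trans ?_
  refine mul_le_of_le_one_right (by positivity) ?_
  rw [one_pow, div_le_one (by positivity)]
  have : (0 : ℝ) ≤ n := Nat.cast_nonneg n
  linarith

end Recursion

/-! ### The greedy density and its asymptotics. -/

section GreedyDensity

variable {d : ℕ}

theorem card_childLetter_root : Fintype.card (ChildLetter (treeRoot d)) = d := by
  rw [Fintype.card_subtype]
  simp [treeRoot]

theorem card_childLetter_of_ne {v : TreeVertex d} (hv : v ≠ treeRoot d) :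
    Fintype.card (ChildLetter v) = d - 1 := by
  obtain ⟨l, hl⟩ := v
  cases l with
  | nil => exact (hv rfl).elim
  | cons b l =>
    rw [Fintype.card_subtype]
    have : (Finset.univ.filter fun a => (a :: b :: l).IsChain (· ≠ ·)) = Finset.univ.erase b := by
      ext a
      simp [List.isChain_cons_cons, hl]
    rw [this, Finset.card_erase_of_mem (Finset.mem_univ b), Finset.card_univ, Fintype.card_fin]

theorem measureReal_mem_rootedGreedySet (n : ℕ) {v : TreeVertex d} (hv : v ≠ treeRoot d) {t : ℝ}
    (ht : t ∈ Set.Icc (0 : ℝ) 1) :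
    (labelMeasure d).real {x | (x v : ℝ) ≤ t ∧ v ∈ rootedGreedySet n x} = joinProb (d - 1) n t := by
  induction n generalizing v t with
  | zero => simp [rootedGreedySet, joinProb]
  | succ n ih =>
    rw [measureReal_rootedGreedySet_succ n v (continuous_joinProb (d - 1) n) (fun a s hs => ih ?_ hs)
      ht, card_childLetter_of_ne hv]
    · rfl
    · intro h
      simpa [childVertex, treeRoot] using congrArg (fun v => v.1.length) h

theorem factorDensity_greedyFactor_succ (m : ℕ) :
    factorDensity (greedyFactor (d := d) (m + 1)) =
      ∫ s in (0 : ℝ)..1, (1 - joinProb (d - 1) (2 * m + 1) s) ^ d := by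
  have h := measureReal_rootedGreedySet_succ (2 * m + 1) (treeRoot d)
    (continuous_joinProb (d - 1) (2 * m + 1)) (fun a s hs =>
      measureReal_mem_rootedGreedySet (2 * m + 1) (v := childVertex (treeRoot d) a) (fun h => by
        simpa [childVertex, treeRoot] using congrArg (fun v => v.1.length) h) hs)
    (⟨zero_le_one, le_rfl⟩ : (1 : ℝ) ∈ Set.Icc (0 : ℝ) 1)
  rw [card_childLetter_root] at h
  rw [← h, factorDensity_greedyFactor]
  congr 1
  ext x
  exact (and_iff_right (x (treeRoot d)).2.2).symm

theorem factorDensity_le_one (f : TreeLabelling d → Bool) : factorDensity f ≤ 1 := measureReal_le_one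

theorem bddAbove_factorDensity (d : ℕ) :
    BddAbove {ρ | ∃ f : TreeLabelling d → Bool, IsIndepSetFactor f ∧ ρ = factorDensity f} :=
  ⟨1, by rintro _ ⟨f, -, rfl⟩; exact factorDensity_le_one f⟩

/-- The density of the greedy independent set bounds the supremum from below. -/
theorem greedy_le_supIndepDensity (hd : 3 ≤ d) :
    (1 - ((d : ℝ) - 1) ^ (-2 / ((d : ℝ) - 2))) / 2 ≤ supIndepDensity d := by
  have hd' : (3 : ℝ) ≤ d := by exact_mod_cast hd
  have h := tendsto_integral_joinProb (k := d - 1) (d := d) (κ := (d : ℝ) - 2) (by linarith)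
    (by rw [Nat.cast_sub (by omega)]; push_cast; ring) (by ring)
  have h2 : Tendsto (fun m : ℕ => 2 * m + 1) atTop atTop :=
    tendsto_atTop_mono (fun m => by simp only [id]; omega) tendsto_id
  have h3 := h.comp h2
  rw [show 1 + ((d : ℝ) - 2) = d - 1 by ring] at h3
  refine le_of_tendsto' h3 fun m => ?_
  refine le_csSup (bddAbove_factorDensity d) ⟨greedyFactor (m + 1), isIndepSetFactor_greedyFactor _, ?_⟩
  exact (factorDensity_greedyFactor_succ m).symm

/-- The greedy density is `(1 - exp (-y)) / 2` with `y = 2 log (d - 1) / (d - 2)`, and `1 - exp (-y)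
≥ y / (1 + y)`. Crude bounds suffice: `d ≥ 4` gives `d ≤ 2 (d - 2)` and `log (d - 1) ≥ log d - log
2`. -/
theorem le_treeAlpha (hd : 4 ≤ d) :
    (1 - Real.log 2 / Real.log d) / (1 + 4 * (Real.log d / d)) ≤ treeAlpha d := by
  have hd' : (4 : ℝ) ≤ d := by exact_mod_cast hd
  have hl : 0 < Real.log d := Real.log_pos (by linarith)
  have hl1 : 0 < Real.log ((d : ℝ) - 1) := Real.log_pos (by linarith)
  rw [treeAlpha, le_div_iff₀ (by positivity)]
  refine le_trans ?_ (greedy_le_supIndepDensity (by omega))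
  set y : ℝ := 2 * Real.log ((d : ℝ) - 1) / (d - 2) with hy
  have hy0 : 0 < y := by
    have : (0 : ℝ) < d - 2 := by linarith
    positivity
  have hexp : ((d : ℝ) - 1) ^ (-2 / ((d : ℝ) - 2)) = Real.exp (-y) := by
    rw [Real.rpow_def_of_pos (by linarith), hy]
    congr 1
    ring
  have h1 : y / (1 + y) ≤ 1 - Real.exp (-y) := by
    have h2 : Real.exp (-y) ≤ 1 / (1 + y) := by
      rw [Real.exp_neg, ← one_div]
      exact one_div_le_one_div_of_le (by linarith) (by linarith [Real.add_one_le_exp y])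
    have h3 : y / (1 + y) = 1 - 1 / (1 + y) := by field_simp; ring
    linarith
  have h4 : y ≤ 4 * (Real.log d / d) := by
    have h5 : Real.log ((d : ℝ) - 1) ≤ Real.log d := Real.log_le_log (by linarith) (by linarith)
    rw [hy, ← mul_div_assoc, div_le_div_iff₀ (by linarith) (by linarith)]
    nlinarith
  have h6 : (1 - Real.log 2 / Real.log d) * (Real.log d / d) ≤ y / 2 := by
    have h7 : Real.log d - Real.log 2 ≤ Real.log ((d : ℝ) - 1) := by
      rw [← Real.log_div (by linarith) two_ne_zero]
      exact Real.log_le_log (by linarith) (by linarith)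
    have h8 : (1 - Real.log 2 / Real.log d) * (Real.log d / d) =
        (Real.log d - Real.log 2) / d := by field_simp
    have h9 : y / 2 = Real.log ((d : ℝ) - 1) / (d - 2) := by rw [hy]; ring
    rw [h8, h9]
    exact div_le_div₀ hl1.le h7 (by linarith) (by linarith)
  rw [hexp]
  calc (1 - Real.log 2 / Real.log d) / (1 + 4 * (Real.log d / d)) * (Real.log d / d)
      = (1 - Real.log 2 / Real.log d) * (Real.log d / d) / (1 + 4 * (Real.log d / d)) := by ring
    _ ≤ y / 2 / (1 + y) := div_le_div₀ (by positivity) h6 (by linarith) (by linarith)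
    _ = y / (1 + y) / 2 := by ring
    _ ≤ (1 - Real.exp (-y)) / 2 := by linarith

end GreedyDensity

theorem tendsto_treeAlpha : Tendsto treeAlpha atTop (𝓝 1) := by
  have hlog : Tendsto (fun d : ℕ => Real.log d) atTop atTop :=
    Real.tendsto_log_atTop.comp tendsto_natCast_atTop_atTop
  have hdiv : Tendsto (fun d : ℕ => Real.log d / d) atTop (𝓝 0) :=
    (Real.isLittleO_log_id_atTop.tendsto_div_nhds_zero).comp tendsto_natCast_atTop_atTop
  rw [tendsto_order]
  constructor
  · intro a ha
    have h1 : Tendsto (fun d : ℕ => (1 - Real.log 2 / Real.log d) / (1 + 4 * (Real.log d / d)))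
        atTop (𝓝 ((1 - 0) / (1 + 4 * 0))) :=
      (tendsto_const_nhds.sub (hlog.const_div_atTop _)).div
        (tendsto_const_nhds.add (hdiv.const_mul 4)) (by norm_num)
    have h2 := h1.eventually_const_lt (u := a) (by norm_num; exact ha)
    filter_upwards [h2, eventually_ge_atTop 4] with d hd hd4
    exact hd.trans_le (le_treeAlpha hd4)
  · intro a ha
    obtain ⟨D, hD⟩ := exists_factorDensity_bound (ε := (a - 1) / 2) (by linarith)
    filter_upwards [eventually_gt_atTop D, hlog.eventually_gt_atTop 0, eventually_gt_atTop 0]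
      with d hd hl hd0
    have hd0' : (0 : ℝ) < d := by exact_mod_cast hd0
    have h1 : supIndepDensity d ≤ (1 + (a - 1) / 2) * (Real.log d / d) := by
      -- The empty independent set shows that the supremum is over a nonempty set.
      refine csSup_le ⟨_, greedyFactor 0, isIndepSetFactor_greedyFactor 0, rfl⟩ ?_
      rintro _ ⟨f, hf, rfl⟩
      exact hD d hd f hf
    have h2 : treeAlpha d ≤ 1 + (a - 1) / 2 := by
      rw [treeAlpha, div_le_iff₀ (by positivity)]
      exact h1
    linarith

theorem theorem2p1 :
    limsup (fun d : ℕ => (treeAlpha d : EReal)) atTop ≤ 1 ∧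
    (∀ ε : ℝ, 0 < ε → ∃ D : ℕ, ∀ d : ℕ, D < d →
      ∀ f : TreeLabelling d → Bool, IsIndepSetFactor f →
        factorDensity f ≤ (1 + ε) * (Real.log d / d)) ∧
    Tendsto treeAlpha atTop (𝓝 1) := by
  refine ⟨?_, fun ε hε => exists_factorDensity_bound hε, tendsto_treeAlpha⟩
  have h : Tendsto (fun d : ℕ => (treeAlpha d : EReal)) atTop (𝓝 ((1 : ℝ) : EReal)) :=
    (continuous_coe_real_ereal.tendsto 1).comp tendsto_treeAlpha
  rw [h.limsup_eq]
  simp
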